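/- Let $q\in\mathbb{C}$ with $|q|<1$. Write $(a;q)_n=\prod_{j=0}^{n-1}(1-aq^j)$, $(a;q)_\infty=\prod_{j\ge 0}(1-aq^j)$ and $(a,b,c;q)_\infty=(a;q)_\infty(b;q)_\infty(c;q)_\infty$. For nonnegative integers $n_1,\dots,n_k$ put $N_j=n_j+n_{j+1}+\cdots+n_k$ for $1\le j\le k$ and $N_j=0$ for $j>k$. Let $k\ge 1$ and $1\le i\le k+1$ be integers, and abbreviate $$Q_i=N_1^2+\cdots+N_k^2+N_i+N_{i+1}+\cdots+N_k$$ (the linear part being $0$ for $i=k+1$). Then each of the following multiple series, summed over all nonnegative integer values of the indicated variables, converges absolutely and has the stated value. (1) $\displaystyle\sum_{m,n_1,\dots,n_k\ge 0}\frac{q^{\binom{m+1}{2}+mn_1+2Q_i}}{(q;q)_m(q;q)_{n_1}(q^2;q^2)_{n_2}\cdots(q^2;q^2)_{n_k}}=\frac{(q^{2i},q^{4k+6-2i},q^{4k+6};q^{4k+6})_\infty}{(q;q)_\infty}.$ (2) $\displaystyle\sum_{m,n_1,\dots,n_k\ge 0}\frac{q^{\binom{m+1}{2}+mn_k+2Q_i}}{(q;q)_m(q^2;q^2)_{n_1}\cdots(q^2;q^2)_{n_{k-1}}(q;q)_{n_k}}=\frac{(q^{2i},q^{4k+6-2i},q^{4k+6};q^{4k+6})_\infty}{(q;q)_\infty}.$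 (3) $\displaystyle\sum_{m_1,m_2,n_1,\dots,n_k\ge 0}\frac{q^{\binom{m_1+1}{2}+m_1m_2+2\binom{m_2+1}{2}+2m_2n_1+4Q_i}}{(q;q)_{m_1}(q;q)_{m_2}(q^2;q^2)_{n_1}(q^4;q^4)_{n_2}\cdots(q^4;q^4)_{n_k}}=\frac{(q^{4i},q^{8k+12-4i},q^{8k+12};q^{8k+12})_\infty}{(q;q)_\infty}.$ (4) With $n_1:=n_{1,1}+2n_{1,2}$, $\displaystyle\sum_{m,n_{1,1},n_{1,2},n_2,\dots,n_k\ge 0}\frac{q^{\binom{m+1}{2}+mn_1+\binom{n_{1,1}}{2}+2Q_i}}{(q;q)_m(q;q)_{n_{1,1}}(q^2;q^2)_{n_{1,2}}(q^2;q^2)_{n_2}\cdots(q^2;q^2)_{n_k}}=\frac{(q^{2i},q^{4k+6-2i},q^{4k+6};q^{4k+6})_\infty}{(q;q)_\infty}.$ (5) $\displaystyle\sum_{m_1,m_2,n_1,\dots,n_k\ge 0}\frac{q^{\binom{m_1+1}{2}+m_1n_1+2\binom{m_2+1}{2}+2m_2n_1+4Q_i}}{(q;q)_{m_1}(q^2;q^2)_{m_2}(q;q)_{n_1}(q^4;q^4)_{n_2}\cdots(q^4;q^4)_{n_k}}=\frac{(q^{4i},q^{8k+12-4i},q^{8k+12};q^{8k+12})_\infty}{(q;q)_\infty}.$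 (6) $\displaystyle\sum_{m_1,m_2,n_1,\dots,n_k\ge 0}\frac{q^{\binom{m_1}{2}+\binom{m_1+2m_2+1}{2}+(m_1+2m_2)n_1+2Q_i}}{(q;q)_{m_1}(q^2;q^2)_{m_2}(q;q)_{n_1}(q^2;q^2)_{n_2}\cdots(q^2;q^2)_{n_k}}=\frac{(q^{2i},q^{4k+6-2i},q^{4k+6};q^{4k+6})_\infty}{(q;q)_\infty}.$ (7) With $n_k:=n_{k,1}+2n_{k,2}$, $\displaystyle\sum_{n_1,\dots,n_{k-1},n_{k,1},n_{k,2}\ge 0}\frac{q^{\binom{n_{k,1}}{2}+Q_i}}{(q;q)_{n_1}\cdots(q;q)_{n_{k-1}}(q;q)_{n_{k,1}}(q^2;q^2)_{n_{k,2}}}=\frac{(q^{i},q^{2k+3-i},q^{2k+3};q^{2k+3})_\infty}{(q;q)_\infty}.$ (8) With $n_1:=n_{1,1}+2n_{1,2}$, $\displaystyle\sum_{n_{1,1},n_{1,2},n_2,\dots,n_k\ge 0}\frac{q^{\binom{n_{1,1}}{2}+Q_i}}{(q;q)_{n_{1,1}}(q^2;q^2)_{n_{1,2}}(q;q)_{n_2}\cdots(q;q)_{n_k}}=\frac{(q^{i},q^{2k+3-i},q^{2k+3};q^{2k+3})_\infty}{(q;q)_\infty}.$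 (9), (10) With $n_1:=n_{1,1}+n_{1,2}$, for $s=1$ and for $s=2$ respectively, $\displaystyle\sum_{m,n_{1,1},n_{1,2},n_2,\dots,n_k\ge 0}\frac{q^{\binom{m+1}{2}+mn_{1,1}+n_{1,1}^2+n_{1,2}^2-n_{1,s}-\binom{n_1}{2}+Q_i}}{(q;q)_m(q;q)_{n_{1,1}}(q^2;q^2)_{n_{1,2}}(q;q)_{n_2}\cdots(q;q)_{n_k}}=\frac{(-q;q)_\infty(q^{i},q^{2k+3-i},q^{2k+3};q^{2k+3})_\infty}{(q;q)_\infty}.$ -/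

import Mathlib

open Finset

/-- The finite `q`-Pochhammer symbol `(a;q)_n = (1 - a)(1 - aq)⋯(1 - aq^(n-1))`. -/
noncomputable def qPoch (a q : ℂ) (n : ℕ) : ℂ := ∏ j ∈ range n, (1 - a * q ^ j)

/-- The infinite `q`-Pochhammer symbol `(a;q)_∞ = ∏_{j ≥ 0} (1 - aq^j)`, for `|q| < 1`. -/
noncomputable def qPochInf (a q : ℂ) : ℂ := ∏' j : ℕ, (1 - a * q ^ j)

/-- For `|q| < 1` the product defining `(a;q)_∞` converges to it. -/
theorem hasProd_qPochInf (a : ℂ) {q : ℂ} (hq : ‖q‖ < 1) :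
    HasProd (fun j : ℕ => 1 - a * q ^ j) (qPochInf a q) := by
  have h : Multipliable (fun j : ℕ => 1 + (-(a * q ^ j))) := by
    apply multipliable_one_add_of_summable
    simp only [norm_neg, norm_mul, norm_pow]
    exact (summable_geometric_of_lt_one (norm_nonneg q) hq).mul_left _
  simp only [← sub_eq_add_neg] at h
  exact h.hasProd

/-- The compressed symbol `(a, b, c; q)_∞ = (a;q)_∞ (b;q)_∞ (c;q)_∞`. -/
noncomputable def qPochInf₃ (a b c q : ℂ) : ℂ := qPochInf a q * qPochInf b q * qPochInf c q

/-- `N_j = n_j + n_{j+1} + ⋯ + n_k` for a vector `n = (n_1, …, n_k)`; it is `0` for `j > k`.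
The entry `n_l` (indices from `1`) is the value of `n` at the element `l - 1` of `Fin k`. -/
def partialN {k : ℕ} (n : Fin k → ℕ) (j : ℕ) : ℕ := ∑ l : Fin k with j ≤ l.val + 1, n l

/-- The exponent `N_1² + ⋯ + N_k² + N_i + N_{i+1} + ⋯ + N_k` for `n = (n_1, …, n_k)`. -/
def agExponent {k : ℕ} (i : ℕ) (n : Fin k → ℕ) : ℕ :=
  ∑ j ∈ Icc 1 k, partialN n j ^ 2 + ∑ j ∈ Icc i k, partialN n j

/-- The vector `(a, t_1, …, t_r)`. -/
def consVec {r : ℕ} (a : ℕ) (t : Fin r → ℕ) : Fin (r + 1) → ℕ := Fin.cons a t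

/-- The vector `(t_1, …, t_r, a)`. -/
def snocVec {r : ℕ} (t : Fin r → ℕ) (a : ℕ) : Fin (r + 1) → ℕ := Fin.snoc t a

/-!
The Andrews–Gordon series is obtained by iterating Bailey's lemma in bilateral form. Put
`β_N = ∑_m α_m / ((q;q)_{N-m} (q;q)_{N+m})`, with `m` running over all integers. By the
`q`-Vandermonde sum, replacing `α_m` by `α_m q^(m²)` replaces `β_N` by
`∑_s q^(s²) β_s / (q;q)_{N-s}`, and the same holds with denominators `(q;q)_{N-m} (q;q)_{N+m+1}`
and exponents `m² + m`, `s² + s`. The two kinds of denominator give the same `β` as soon as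
`α_m q^m` is odd under `m ↦ -1 - m`, so the two steps can be mixed, which produces the linear part
of the exponent. Starting from `β_N = 1 / (q;q)_N`, whose `α` is a theta term, every `α` that
occurs is a theta term; as `N → ∞`, `β` becomes the multiple series, and the theta series in the
limit is summed by the Jacobi triple product.

The ten series arise from Andrews–Gordon series by replacing one factor of the general term with a
sum: `(-q;q)_∞ / (q²;q²)_n = ∑_m q^(m(m+1)/2 + mn) / ((q;q)_m (q;q)_n)` is Euler's expansion of
`(-q^(n+1);q)_∞`, while comparing coefficients of `X^n` in `(-X;q)_∞ / (X²;q²)_∞ = 1 / (X;q)_∞` and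
in `(-X;q²)_∞ (-qX;q²)_∞ = (-X;q)_∞` splits `n` as `a + 2b` and as `a + b`.
-/

section

open Filter Topology PowerSeries

theorem qPoch_zero (a q : ℂ) : qPoch a q 0 = 1 := by simp [qPoch]

theorem qPoch_succ (a q : ℂ) (n : ℕ) : qPoch a q (n + 1) = qPoch a q n * (1 - a * q ^ n) := by
  simp [qPoch, prod_range_succ]

theorem qPoch_self_succ (q : ℂ) (n : ℕ) :
    qPoch q q (n + 1) = qPoch q q n * (1 - q ^ (n + 1)) := by
  rw [qPoch_succ, pow_succ']

theorem qPoch_mul_qPoch_neg (q : ℂ) (n : ℕ) :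
    qPoch q q n * qPoch (-q) q n = qPoch (q ^ 2) (q ^ 2) n := by
  rw [qPoch, qPoch, qPoch, ← prod_mul_distrib]
  exact prod_congr rfl fun j _ => by ring

theorem norm_pow_lt_one {q : ℂ} (hq : ‖q‖ < 1) {n : ℕ} (hn : n ≠ 0) : ‖q ^ n‖ < 1 := by
  rw [norm_pow]
  exact pow_lt_one₀ (norm_nonneg q) hq hn

theorem one_sub_ne_zero_of_norm_lt_one {z : ℂ} (hz : ‖z‖ < 1) : 1 - z ≠ 0 := by
  rw [sub_ne_zero]
  rintro rfl
  simp at hz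

theorem one_sub_pow_succ_ne_zero {q : ℂ} (hq : ‖q‖ < 1) (n : ℕ) : 1 - q ^ (n + 1) ≠ 0 :=
  one_sub_ne_zero_of_norm_lt_one (norm_pow_lt_one hq n.succ_ne_zero)

theorem one_sub_mul_pow_ne_zero {a q : ℂ} (ha : ‖a‖ < 1) (hq : ‖q‖ < 1) (n : ℕ) :
    1 - a * q ^ n ≠ 0 := by
  refine one_sub_ne_zero_of_norm_lt_one ?_
  rw [norm_mul, norm_pow]
  exact mul_lt_one_of_nonneg_of_lt_one_left (norm_nonneg a) ha (pow_le_one₀ (norm_nonneg q) hq.le)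

theorem qPoch_ne_zero {a q : ℂ} (ha : ‖a‖ < 1) (hq : ‖q‖ < 1) (n : ℕ) : qPoch a q n ≠ 0 :=
  prod_ne_zero_iff.mpr fun j _ => one_sub_mul_pow_ne_zero ha hq j

theorem tendsto_qPoch (a : ℂ) {q : ℂ} (hq : ‖q‖ < 1) :
    Tendsto (qPoch a q) atTop (𝓝 (qPochInf a q)) :=
  (hasProd_qPochInf a hq).tendsto_prod_nat

theorem qPochInf_ne_zero {a q : ℂ} (ha : ‖a‖ < 1) (hq : ‖q‖ < 1) : qPochInf a q ≠ 0 := by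
  have h := tprod_one_add_ne_zero_of_summable (f := fun j : ℕ => -(a * q ^ j))
    (fun j => by simpa only [← sub_eq_add_neg] using one_sub_mul_pow_ne_zero ha hq j)
    (by
      simp only [norm_neg, norm_mul, norm_pow]
      exact (summable_geometric_of_lt_one (norm_nonneg q) hq).mul_left _)
  simpa only [qPochInf, ← sub_eq_add_neg] using h

theorem qPochInf_mul_qPochInf_neg {q : ℂ} (hq : ‖q‖ < 1) :
    qPochInf q q * qPochInf (-q) q = qPochInf (q ^ 2) (q ^ 2) := by
  have h := (tendsto_qPoch q hq).mul (tendsto_qPoch (-q) hq)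
  simp only [qPoch_mul_qPoch_neg] at h
  exact tendsto_nhds_unique h (tendsto_qPoch _ (norm_pow_lt_one hq two_ne_zero))

theorem qPoch_mul_qPochInf (a : ℂ) {q : ℂ} (hq : ‖q‖ < 1) (n : ℕ) :
    qPoch a q n * qPochInf (a * q ^ n) q = qPochInf a q := by
  have key : ∀ m, qPoch a q (n + m) = qPoch a q n * qPoch (a * q ^ n) q m := fun m => by
    simp only [qPoch, prod_range_add, pow_add, mul_assoc]
  refine tendsto_nhds_unique ((tendsto_qPoch _ hq).const_mul _) ?_
  simpa only [← key, add_comm n] using (tendsto_add_atTop_iff_nat n).mpr (tendsto_qPoch a hq)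

theorem one_sub_pow_mul_inv_qPoch {q : ℂ} (hq : ‖q‖ < 1) (n : ℕ) :
    (1 - q ^ (n + 1)) * (qPoch q q (n + 1))⁻¹ = (qPoch q q n)⁻¹ := by
  have h := one_sub_pow_succ_ne_zero hq n
  rw [qPoch_self_succ, mul_inv, mul_left_comm, mul_inv_cancel₀ h, mul_one]

theorem exists_norm_qPoch_le (a : ℂ) {q : ℂ} (hq : ‖q‖ < 1) : ∃ C : ℝ, ∀ n, ‖qPoch a q n‖ ≤ C :=
  let ⟨C, hC⟩ := (tendsto_qPoch a hq).norm.bddAbove_range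
  ⟨C, fun n => hC ⟨n, rfl⟩⟩

theorem exists_norm_inv_qPoch_le {a q : ℂ} (ha : ‖a‖ < 1) (hq : ‖q‖ < 1) :
    ∃ C : ℝ, ∀ n, ‖(qPoch a q n)⁻¹‖ ≤ C :=
  let ⟨C, hC⟩ := ((tendsto_qPoch a hq).inv₀ (qPochInf_ne_zero ha hq)).norm.bddAbove_range
  ⟨C, fun n => hC ⟨n, rfl⟩⟩

/-- The reciprocal `1 / (q;q)_n` as a function of an integer `n`, with the usual convention that
it vanishes for `n < 0`; this lets all `q`-binomial sums run over `ℤ`. -/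
noncomputable def invQPoch (q : ℂ) (n : ℤ) : ℂ := if 0 ≤ n then (qPoch q q n.toNat)⁻¹ else 0

theorem invQPoch_natCast (q : ℂ) (n : ℕ) : invQPoch q n = (qPoch q q n)⁻¹ := by
  simp [invQPoch]

theorem invQPoch_of_neg (q : ℂ) {n : ℤ} (hn : n < 0) : invQPoch q n = 0 :=
  if_neg hn.not_ge

theorem invQPoch_zero (q : ℂ) : invQPoch q 0 = 1 := by
  simp [invQPoch, qPoch_zero]

theorem one_sub_zpow_mul_invQPoch {q : ℂ} (hq : ‖q‖ < 1) (n : ℤ) :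
    (1 - q ^ n) * invQPoch q n = invQPoch q (n - 1) := by
  obtain hn | rfl | hn := lt_trichotomy n 0
  · rw [invQPoch_of_neg q hn, invQPoch_of_neg q (by lia), mul_zero]
  · simp [invQPoch_of_neg]
  · obtain ⟨m, rfl⟩ : ∃ m : ℕ, n = (m + 1 : ℕ) := ⟨n.toNat - 1, by lia⟩
    rw [show ((m + 1 : ℕ) : ℤ) - 1 = (m : ℕ) by lia, zpow_natCast, invQPoch_natCast,
      invQPoch_natCast, one_sub_pow_mul_inv_qPoch hq]

theorem exists_norm_invQPoch_le {q : ℂ} (hq : ‖q‖ < 1) : ∃ C : ℝ, ∀ n, ‖invQPoch q n‖ ≤ C := by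
  obtain ⟨C, hC⟩ := exists_norm_inv_qPoch_le hq hq
  refine ⟨C, fun n => ?_⟩
  unfold invQPoch
  split_ifs
  · exact hC _
  · exact norm_zero.trans_le ((norm_nonneg _).trans (hC 0))

theorem tendsto_invQPoch {q : ℂ} (hq : ‖q‖ < 1) :
    Tendsto (invQPoch q) atTop (𝓝 (qPochInf q q)⁻¹) := by
  rw [← Nat.map_cast_int_atTop, tendsto_map'_iff]
  exact ((tendsto_qPoch q hq).inv₀ (qPochInf_ne_zero hq hq)).congr fun n =>
    (invQPoch_natCast q n).symm

theorem tendsto_invQPoch_natCast_add {q : ℂ} (hq : ‖q‖ < 1) (s : ℤ) :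
    Tendsto (fun N : ℕ => invQPoch q (N + s)) atTop (𝓝 (qPochInf q q)⁻¹) :=
  (tendsto_invQPoch hq).comp (tendsto_atTop_add_const_right _ s tendsto_natCast_atTop_atTop)

theorem tendsto_tsum_mul_of_bounded {𝕜 I X : Type*} [NormedField 𝕜] [CompleteSpace 𝕜]
    {l : Filter I} {c : X → 𝕜} {K : I → X → 𝕜} {L : 𝕜} {C : ℝ} (hc : Summable fun x => ‖c x‖)
    (hK : ∀ N x, ‖K N x‖ ≤ C) (hL : ∀ x, Tendsto (K · x) l (𝓝 L)) :
    Tendsto (fun N => ∑' x, c x * K N x) l (𝓝 ((∑' x, c x) * L)) := by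
  rw [← tsum_mul_right]
  refine tendsto_tsum_of_dominated_convergence (hc.mul_right C)
    (fun x => (hL x).const_mul (c x)) (.of_forall fun N x => ?_)
  rw [norm_mul]
  exact mul_le_mul_of_nonneg_left (hK N x) (norm_nonneg _)

theorem constantCoeff_rescale {R : Type*} [CommRing R] (a : R) (F : R⟦X⟧) :
    constantCoeff (rescale a F) = constantCoeff F := by
  rw [← coeff_zero_eq_constantCoeff_apply, coeff_rescale, pow_zero, one_mul,
    coeff_zero_eq_constantCoeff_apply]

theorem powerSeries_eq_of_mul_eq_mul_rescale {R : Type*} [CommRing R] [IsDomain R] {p : R}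
    (hp : ∀ n, 1 - p ^ (n + 1) ≠ 0) {A P F G : R⟦X⟧}
    (hA : constantCoeff A = 1) (hP : constantCoeff P = 1)
    (hF : A * F = P * rescale p F) (hG : A * G = P * rescale p G)
    (h0 : constantCoeff F = constantCoeff G) : F = G := by
  have hdvd : ∀ n, X ^ (n + 1) ∣ F - G := fun n => by
    induction n with
    | zero => rw [zero_add, pow_one, X_dvd_iff, map_sub, h0, sub_self]
    | succ n ih =>
      obtain ⟨E, hE⟩ := ih
      have hE' : X ^ (n + 1) * (A * E) = X ^ (n + 1) * (C (p ^ (n + 1)) * (P * rescale p E)) := by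
        calc _ = A * F - A * G := by rw [← mul_sub, hE]; ring
          _ = P * rescale p (F - G) := by rw [hF, hG, map_sub, mul_sub]
          _ = _ := by
            rw [hE, map_mul, map_pow, rescale_X, mul_pow, ← map_pow]
            ring
      have h := congrArg constantCoeff (mul_left_cancel₀ (pow_ne_zero _ X_ne_zero) hE')
      have hE0 : constantCoeff E = 0 := by
        refine (mul_eq_zero.mp ?_).resolve_left (hp n)
        rw [map_mul, map_mul, map_mul, hA, hP, constantCoeff_C, constantCoeff_rescale, one_mul] at h
        rw [sub_mul, one_mul, ← h, sub_self]
      rw [hE, pow_succ X (n + 1)]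
      exact mul_dvd_mul_left _ (X_dvd_iff.mpr hE0)
  exact sub_eq_zero.mp (PowerSeries.ext fun n => X_pow_dvd_iff.mp (hdvd n) n n.lt_succ_self)

theorem rescale_expand {R : Type*} [CommRing R] (a : R) {p : ℕ} (hp : p ≠ 0) (F : R⟦X⟧) :
    rescale a (expand p hp F) = expand p hp (rescale (a ^ p) F) := by
  ext n
  simp only [coeff_rescale, coeff_expand]
  split_ifs with h
  · obtain ⟨m, rfl⟩ := h
    rw [Nat.mul_div_cancel_left m (Nat.pos_of_ne_zero hp), pow_mul]
  · rw [mul_zero]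

/-- The series `∑ q^(n(n-1)/2) X^n / (q;q)_n`, which expands `(-X;q)_∞`. -/
noncomputable def eulerSeries (q : ℂ) : ℂ⟦X⟧ := mk fun n => q ^ n.choose 2 / qPoch q q n

/-- The series `∑ X^n / (q;q)_n`, which expands `1 / (X;q)_∞`. -/
noncomputable def invEulerSeries (q : ℂ) : ℂ⟦X⟧ := mk fun n => (qPoch q q n)⁻¹

theorem coeff_eulerSeries (q : ℂ) (n : ℕ) :
    coeff n (eulerSeries q) = q ^ n.choose 2 * (qPoch q q n)⁻¹ := by
  rw [eulerSeries, coeff_mk, div_eq_mul_inv]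

theorem coeff_invEulerSeries (q : ℂ) (n : ℕ) : coeff n (invEulerSeries q) = (qPoch q q n)⁻¹ :=
  coeff_mk n _

theorem constantCoeff_eulerSeries (q : ℂ) : constantCoeff (eulerSeries q) = 1 := by
  simp [eulerSeries, qPoch_zero]

theorem constantCoeff_invEulerSeries (q : ℂ) : constantCoeff (invEulerSeries q) = 1 := by
  simp [invEulerSeries, qPoch_zero]

theorem eulerSeries_eq_one_add_X_mul {q : ℂ} (hq : ‖q‖ < 1) :
    eulerSeries q = (1 + X) * rescale q (eulerSeries q) := by
  ext n
  rw [add_mul, one_mul, map_add]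
  cases n with
  | zero => simp [eulerSeries, qPoch_zero]
  | succ n =>
    rw [coeff_succ_X_mul, coeff_rescale, coeff_rescale, coeff_eulerSeries, coeff_eulerSeries,
      ← one_sub_pow_mul_inv_qPoch hq n, Nat.choose_succ_succ' n 1, Nat.choose_one_right]
    ring

theorem one_sub_X_mul_invEulerSeries {q : ℂ} (hq : ‖q‖ < 1) :
    (1 - X) * invEulerSeries q = rescale q (invEulerSeries q) := by
  ext n
  rw [sub_mul, one_mul, map_sub]
  cases n with
  | zero => simp [invEulerSeries, qPoch_zero]
  | succ n =>
    rw [coeff_succ_X_mul, coeff_rescale, coeff_invEulerSeries, coeff_invEulerSeries,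
      ← one_sub_pow_mul_inv_qPoch hq n]
    ring

theorem eulerSeries_mul_expand_invEulerSeries {q : ℂ} (hq : ‖q‖ < 1) :
    eulerSeries q * expand 2 two_ne_zero (invEulerSeries (q ^ 2)) = invEulerSeries q := by
  have hq2 := norm_pow_lt_one hq two_ne_zero
  refine powerSeries_eq_of_mul_eq_mul_rescale (A := 1 - X ^ 2) (P := 1 + X)
    (one_sub_pow_succ_ne_zero hq) (by simp) (by simp) ?_ ?_ ?_
  · have h : (1 - X ^ 2) * expand 2 two_ne_zero (invEulerSeries (q ^ 2)) =
        rescale q (expand 2 two_ne_zero (invEulerSeries (q ^ 2))) := by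
      rw [rescale_expand, ← one_sub_X_mul_invEulerSeries hq2, map_mul, map_sub, map_one, expand_X]
    rw [map_mul, ← h]
    conv_lhs => rw [eulerSeries_eq_one_add_X_mul hq]
    ring
  · rw [← one_sub_X_mul_invEulerSeries hq]
    ring
  · rw [map_mul, constantCoeff_expand, constantCoeff_eulerSeries, constantCoeff_invEulerSeries,
      constantCoeff_invEulerSeries, one_mul]

theorem eulerSeries_sq_mul_rescale_eulerSeries_sq {q : ℂ} (hq : ‖q‖ < 1) :
    eulerSeries (q ^ 2) * rescale q (eulerSeries (q ^ 2)) = eulerSeries q := by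
  have hq2 := norm_pow_lt_one hq two_ne_zero
  refine powerSeries_eq_of_mul_eq_mul_rescale (A := 1) (P := (1 + X) * rescale q (1 + X))
    (one_sub_pow_succ_ne_zero hq2) (by simp) (by simp) ?_ ?_ ?_
  · rw [map_mul, one_mul]
    conv_lhs => rw [eulerSeries_eq_one_add_X_mul hq2]
    rw [map_mul, rescale_rescale, rescale_rescale, mul_comm q]
    ring
  · conv_lhs => rw [eulerSeries_eq_one_add_X_mul hq, eulerSeries_eq_one_add_X_mul hq]
    rw [map_mul, rescale_rescale, ← sq]
    ring
  · rw [map_mul, constantCoeff_rescale, constantCoeff_eulerSeries, constantCoeff_eulerSeries,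
      one_mul]

theorem rescale_eulerSeries_mul_invEulerSeries {q : ℂ} (hq : ‖q‖ < 1) (x : ℂ) :
    rescale x (eulerSeries q) * invEulerSeries q =
      mk fun n => qPoch (-x) q n * (qPoch q q n)⁻¹ := by
  refine powerSeries_eq_of_mul_eq_mul_rescale (A := 1 - X) (P := rescale x (1 + X))
    (one_sub_pow_succ_ne_zero hq) (by simp) (by simp) ?_ ?_ ?_
  · have h : rescale x (eulerSeries q) =
        rescale x (1 + X) * rescale q (rescale x (eulerSeries q)) := by
      conv_lhs => rw [eulerSeries_eq_one_add_X_mul hq]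
      rw [map_mul, rescale_rescale, rescale_rescale, mul_comm q]
    conv_lhs => rw [h]
    rw [map_mul, ← one_sub_X_mul_invEulerSeries hq]
    ring
  · ext n
    rw [map_add, map_one, rescale_X, sub_mul, add_mul, one_mul, one_mul, mul_assoc, map_sub,
      map_add, coeff_C_mul]
    cases n with
    | zero => simp
    | succ n =>
      simp only [coeff_succ_X_mul, coeff_rescale, coeff_mk, ← one_sub_pow_mul_inv_qPoch hq n,
        qPoch_succ (-x)]
      ring
  · simp [constantCoeff_rescale, constantCoeff_eulerSeries, constantCoeff_invEulerSeries,
      qPoch_zero]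

/-- The general term `(-b)^m Q^(m(m-1)/2)`, `m ∈ ℤ`, of the theta series `∑ (-b)^m Q^(m(m-1)/2)`;
the exponent is written with the binomial coefficient of an integer. -/
noncomputable def thetaTerm (b Q : ℂ) (m : ℤ) : ℂ := (-b) ^ m * Q ^ Ring.choose m 2

theorem two_mul_ringChoose_two (m : ℤ) : 2 * Ring.choose m 2 = m * (m - 1) := by
  have h := Ring.descPochhammer_eq_factorial_smul_choose m 2
  rw [← Polynomial.aeval_eq_smeval] at h
  simpa [descPochhammer_succ_right, eq_comm] using h

theorem thetaTerm_natCast (b Q : ℂ) (n : ℕ) : thetaTerm b Q n = (-b) ^ n * Q ^ n.choose 2 := by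
  rw [thetaTerm, Ring.choose_natCast, zpow_natCast, zpow_natCast]

theorem thetaTerm_neg (b : ℂ) {Q : ℂ} (hQ : Q ≠ 0) (m : ℤ) :
    thetaTerm b Q (-m) = thetaTerm (Q / b) Q m := by
  have h : Ring.choose (-m) 2 = m + Ring.choose m 2 := by
    linarith [two_mul_ringChoose_two m, two_mul_ringChoose_two (-m)]
  have hQb : -(Q / b) = Q * (-b)⁻¹ := by rw [div_eq_mul_inv, inv_neg, mul_neg]
  rw [thetaTerm, thetaTerm, h, zpow_add₀ hQ, zpow_neg, ← inv_zpow, hQb, mul_zpow]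
  ring

theorem thetaTerm_neg_one_sub {Q : ℂ} (hQ : Q ≠ 0) (m : ℤ) :
    thetaTerm Q Q (-1 - m) = -thetaTerm Q Q m := by
  have h : (-1 - m) + Ring.choose (-1 - m) 2 = m + Ring.choose m 2 := by
    linarith [two_mul_ringChoose_two m, two_mul_ringChoose_two (-1 - m)]
  simp only [thetaTerm, neg_eq_neg_one_mul Q, mul_zpow, mul_assoc, ← zpow_add₀ hQ, h]
  rw [zpow_sub₀ (by norm_num), zpow_neg_one, inv_neg_one, div_eq_mul_inv, ← inv_zpow,
    inv_neg_one, mul_assoc, neg_one_mul]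

theorem thetaTerm_mul_zpow_sq {b q Q : ℂ} (hq : q ≠ 0) (m : ℤ) :
    thetaTerm b Q m * q ^ m ^ 2 = thetaTerm (b * q) (Q * q ^ 2) m := by
  have h : m ^ 2 = m + 2 * Ring.choose m 2 := by linarith [two_mul_ringChoose_two m]
  rw [thetaTerm, thetaTerm, ← neg_mul, mul_zpow, mul_zpow, h, zpow_add₀ hq, zpow_mul, zpow_ofNat]
  ring

theorem summable_pow_mul_pow_choose_two {𝕜 : Type*} [NormedField 𝕜] [CompleteSpace 𝕜] (z : 𝕜)
    {q : 𝕜} (hq : ‖q‖ < 1) :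
    Summable fun n : ℕ => z ^ n * q ^ n.choose 2 := by
  have hlim : Tendsto (fun n : ℕ => ‖z‖ * ‖q‖ ^ n) atTop (𝓝 0) := by
    simpa using (tendsto_pow_atTop_nhds_zero_of_lt_one (norm_nonneg q) hq).const_mul ‖z‖
  refine summable_of_ratio_norm_eventually_le one_half_lt_one ?_
  filter_upwards [hlim.eventually_le_const one_half_pos] with n hn
  calc ‖z ^ (n + 1) * q ^ (n + 1).choose 2‖ = ‖z‖ * ‖q‖ ^ n * ‖z ^ n * q ^ n.choose 2‖ := by
        rw [Nat.choose_succ_succ' n 1, Nat.choose_one_right]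
        simp only [norm_mul, norm_pow, pow_add]
        ring
    _ ≤ 1 / 2 * ‖z ^ n * q ^ n.choose 2‖ := mul_le_mul_of_nonneg_right hn (norm_nonneg _)

theorem summable_thetaTerm (b : ℂ) {Q : ℂ} (hQ : ‖Q‖ < 1) : Summable (thetaTerm b Q) := by
  obtain rfl | hQ0 := eq_or_ne Q 0
  · refine summable_of_ne_finset_zero (s := {0, 1}) fun m hm => ?_
    have hchoose : Ring.choose m 2 ≠ 0 := by
      intro h
      obtain h0 | h1 := mul_eq_zero.mp ((two_mul_ringChoose_two m).symm.trans (by rw [h, mul_zero]))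
      · exact hm (by simp [h0])
      · exact hm (by simp [sub_eq_zero.mp h1])
    rw [thetaTerm, zero_zpow _ hchoose, mul_zero]
  refine .of_nat_of_neg ?_ ?_
  · simpa only [thetaTerm_natCast] using summable_pow_mul_pow_choose_two (-b) hQ
  · simpa only [thetaTerm_neg b hQ0, thetaTerm_natCast] using
      summable_pow_mul_pow_choose_two (-(Q / b)) hQ

theorem hasSum_qBinomial_nat {q : ℂ} (hq : ‖q‖ < 1) (b : ℂ) (n : ℕ) :
    HasSum (fun j : ℕ => (-b) ^ j * q ^ j.choose 2 / qPoch q q j * invQPoch q (n - j))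
      (qPoch b q n / qPoch q q n) := by
  have h := congrArg (coeff n) (rescale_eulerSeries_mul_invEulerSeries hq (-b))
  rw [coeff_mul, Nat.sum_antidiagonal_eq_sum_range_succ_mk, coeff_mk, neg_neg,
    ← div_eq_mul_inv] at h
  rw [← h]
  convert hasSum_sum_of_ne_finset_zero (s := range (n + 1)) (L := .unconditional ℕ) ?_ using 1
  · refine sum_congr rfl fun j hj => ?_
    rw [← Nat.cast_sub (by grind), invQPoch_natCast, coeff_rescale, coeff_eulerSeries,
      coeff_invEulerSeries, div_eq_mul_inv]
    ring
  · intro j hj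
    rw [invQPoch_of_neg q (by grind), mul_zero]

theorem hasSum_qBinomial {q : ℂ} (hq : ‖q‖ < 1) (b : ℂ) (n : ℕ) :
    HasSum (fun j : ℤ => thetaTerm b q j * (invQPoch q j * invQPoch q (n - j)))
      (qPoch b q n / qPoch q q n) := by
  refine (Nat.cast_injective.hasSum_iff fun j hj => ?_).mp
    ((hasSum_qBinomial_nat hq b n).congr_fun fun j => ?_)
  · rw [invQPoch_of_neg q (not_le.mp fun h => hj ⟨j.toNat, by simpa⟩)]
    ring
  · rw [Function.comp, thetaTerm_natCast, invQPoch_natCast, div_eq_mul_inv, mul_assoc (_ * _)]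

theorem hasSum_euler {q : ℂ} (hq : ‖q‖ < 1) (b : ℂ) :
    HasSum (fun j : ℕ => (-b) ^ j * q ^ j.choose 2 / qPoch q q j) (qPochInf b q) := by
  obtain ⟨C, hC⟩ := exists_norm_invQPoch_le hq
  have hsum : Summable fun j : ℕ => (-b) ^ j * q ^ j.choose 2 / qPoch q q j := by
    refine .of_norm_bounded ((summable_pow_mul_pow_choose_two (-b) hq).norm.mul_right C)
      fun j => ?_
    rw [div_eq_mul_inv, norm_mul, ← invQPoch_natCast]
    exact mul_le_mul_of_nonneg_left (hC _) (norm_nonneg _)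
  have hlim := tendsto_tsum_mul_of_bounded (K := fun n j : ℕ => invQPoch q (n - j)) hsum.norm
    (fun n j => hC _) fun j => tendsto_invQPoch_natCast_add hq (-j)
  simp only [(hasSum_qBinomial_nat hq b _).tsum_eq] at hlim
  have hlim' := ((tendsto_qPoch b hq).mul ((tendsto_qPoch q hq).inv₀ (qPochInf_ne_zero hq hq)))
  have h := tendsto_nhds_unique hlim hlim'
  rw [← mul_right_cancel₀ (inv_ne_zero (qPochInf_ne_zero hq hq)) h]
  exact hsum.hasSum

theorem thetaTerm_ne_zero {b Q : ℂ} (hb : b ≠ 0) (hQ : Q ≠ 0) (m : ℤ) : thetaTerm b Q m ≠ 0 :=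
  mul_ne_zero (zpow_ne_zero _ (neg_ne_zero.mpr hb)) (zpow_ne_zero _ hQ)

theorem thetaTerm_mul_zpow (b q Q : ℂ) (m : ℤ) :
    thetaTerm b Q m * q ^ m = thetaTerm (b * q) Q m := by
  rw [thetaTerm, thetaTerm, ← neg_mul, mul_zpow]
  ring

theorem thetaTerm_add {b Q : ℂ} (hb : b ≠ 0) (hQ : Q ≠ 0) (n m : ℤ) :
    thetaTerm b Q (n + m) = thetaTerm b Q n * thetaTerm (b * Q ^ n) Q m := by
  have h : Ring.choose (n + m) 2 = Ring.choose n 2 + (n * m + Ring.choose m 2) := by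
    linarith [two_mul_ringChoose_two m, two_mul_ringChoose_two n, two_mul_ringChoose_two (n + m)]
  rw [thetaTerm, thetaTerm, thetaTerm, h, zpow_add₀ hQ, zpow_add₀ hQ,
    zpow_add₀ (neg_ne_zero.mpr hb), ← neg_mul, mul_zpow, ← zpow_mul]
  ring

theorem qPoch_div_pow_eq_thetaTerm_mul {b q : ℂ} (hb : b ≠ 0) (hq : q ≠ 0) (N : ℕ) :
    qPoch (b / q ^ N) q N = thetaTerm (b / q ^ N) q N * qPoch (q / b) q N := by
  have h1 : thetaTerm (b / q ^ N) q N = ∏ j ∈ range N, -(b / q ^ N * q ^ j) := by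
    rw [thetaTerm_natCast, Nat.choose_two_right, ← sum_range_id, ← prod_pow_eq_pow_sum]
    simp only [← neg_mul, prod_mul_distrib, prod_const, card_range]
  have h2 : qPoch (q / b) q N = ∏ j ∈ range N, (1 - q ^ (N - j) / b) := by
    rw [qPoch, ← prod_range_reflect]
    refine prod_congr rfl fun j hj => ?_
    rw [div_mul_eq_mul_div, ← pow_succ']
    grind
  rw [qPoch, h1, h2, ← prod_mul_distrib]
  refine prod_congr rfl fun j hj => ?_
  rw [pow_sub₀ q hq (mem_range.mp hj).le]
  field_simp
  ring

/-- The sum `β_N = ∑_m α_m / ((q;q)_{N-m} (q;q)_{N+m+e})` over `m ∈ ℤ`: up to normalisation, and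
with `α` unfolded to a bilateral sequence, the `β` of the Bailey pair relative to `q^e`. -/
noncomputable def baileySum (q : ℂ) (e : ℕ) (α : ℤ → ℂ) (N : ℕ) : ℂ :=
  ∑' m : ℤ, α m * (invQPoch q (N - m) * invQPoch q (N + m + e))

theorem hasSum_baileySum (q : ℂ) (e : ℕ) (α : ℤ → ℂ) (N : ℕ) :
    HasSum (fun m : ℤ => α m * (invQPoch q (N - m) * invQPoch q (N + m + e)))
      (baileySum q e α N) := by
  refine (summable_of_ne_finset_zero (s := Icc (-(N + e : ℤ)) N) fun m hm => ?_).hasSum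
  rw [mem_Icc, not_and_or] at hm
  obtain hm | hm := hm
  · rw [invQPoch_of_neg q (n := N + m + e) (by lia), mul_zero, mul_zero]
  · rw [invQPoch_of_neg q (n := N - m) (by lia), zero_mul, mul_zero]

theorem tendsto_baileySum {q : ℂ} (hq : ‖q‖ < 1) (e : ℕ) {α : ℤ → ℂ} (hα : Summable α) :
    Tendsto (baileySum q e α) atTop (𝓝 ((∑' m, α m) * ((qPochInf q q)⁻¹ * (qPochInf q q)⁻¹))) := by
  obtain ⟨C, hC⟩ := exists_norm_invQPoch_le hq
  refine tendsto_tsum_mul_of_bounded (C := C * C) hα.norm (fun N m => ?_) fun m => ?_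
  · rw [norm_mul]
    exact mul_le_mul (hC _) (hC _) (norm_nonneg _) ((norm_nonneg _).trans (hC 0))
  · simpa only [sub_eq_add_neg, add_assoc] using
      (tendsto_invQPoch_natCast_add hq (-m)).mul (tendsto_invQPoch_natCast_add hq (m + e))

theorem baileySum_thetaTerm {b q : ℂ} (hb : b ≠ 0) (hq0 : q ≠ 0) (hq : ‖q‖ < 1) (N : ℕ) :
    baileySum q 0 (thetaTerm b q) N =
      qPoch b q N * qPoch (q / b) q N / qPoch q q (2 * N) := by
  have hbN : b / q ^ N ≠ 0 := div_ne_zero hb (pow_ne_zero _ hq0)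
  have hbin := (Equiv.addLeft (N : ℤ)).hasSum_iff.mpr (hasSum_qBinomial hq (b / q ^ N) (2 * N))
  have hsum := (hasSum_baileySum q 0 (thetaTerm b q) N).mul_left (thetaTerm (b / q ^ N) q N)
  have hval : thetaTerm (b / q ^ N) q N * baileySum q 0 (thetaTerm b q) N =
      qPoch (b / q ^ N) q (2 * N) / qPoch q q (2 * N) := by
    refine hsum.unique (hbin.congr_fun fun m => ?_)
    rw [Function.comp, Equiv.coe_addLeft, thetaTerm_add hbN hq0, zpow_natCast,
      div_mul_cancel₀ b (pow_ne_zero _ hq0), Nat.cast_mul, Nat.cast_zero, add_zero,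
      show ((2 : ℕ) : ℤ) * N - (N + m) = N - m by push_cast; ring]
    ring
  have hsplit : qPoch (b / q ^ N) q (2 * N) = qPoch (b / q ^ N) q N * qPoch b q N := by
    simp only [qPoch, two_mul, prod_range_add, pow_add, ← mul_assoc,
      div_mul_cancel₀ b (pow_ne_zero N hq0)]
  refine mul_left_cancel₀ (thetaTerm_ne_zero hbN hq0 N) ?_
  rw [hval, hsplit, qPoch_div_pow_eq_thetaTerm_mul hb hq0]
  ring

theorem tsum_thetaTerm {b q : ℂ} (hb : b ≠ 0) (hq0 : q ≠ 0) (hq : ‖q‖ < 1) :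
    ∑' m : ℤ, thetaTerm b q m = qPochInf₃ b (q / b) q q := by
  have hP := qPochInf_ne_zero hq hq
  have h1 := tendsto_baileySum hq 0 (summable_thetaTerm b hq)
  have h2 := ((tendsto_qPoch b hq).mul (tendsto_qPoch (q / b) hq)).div
    ((tendsto_qPoch q hq).comp (tendsto_id.const_mul_atTop' two_pos)) hP
  have h := tendsto_nhds_unique h1 (h2.congr fun N => (baileySum_thetaTerm hb hq0 hq N).symm)
  rw [qPochInf₃]
  field_simp at h
  rw [h]
  ring

theorem one_sub_zpow_mul_invQPoch_mul_invQPoch {q : ℂ} (hq0 : q ≠ 0) (hq : ‖q‖ < 1) (n t : ℤ) :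
    (1 - q ^ n) * (invQPoch q (n - t) * invQPoch q t) =
      invQPoch q (n - 1 - t) * invQPoch q t +
        q ^ (n - t) * (invQPoch q (n - t) * invQPoch q (t - 1)) := by
  have hn : q ^ n = q ^ (n - t) * q ^ t := by rw [← zpow_add₀ hq0, sub_add_cancel]
  rw [sub_right_comm, ← one_sub_zpow_mul_invQPoch hq (n - t), ← one_sub_zpow_mul_invQPoch hq t, hn]
  ring

theorem hasSum_qVandermonde_nat {q : ℂ} (hq0 : q ≠ 0) (hq : ‖q‖ < 1) (M : ℕ) (c : ℤ) :
    HasSum (fun t : ℤ =>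
        q ^ (t * (t + c)) * (invQPoch q (M - t) * (invQPoch q t * invQPoch q (t + c))))
      (invQPoch q M * invQPoch q (M + c)) := by
  induction M generalizing c with
  | zero =>
    convert hasSum_single (0 : ℤ) fun t ht => ?_ using 1
    · simp [invQPoch_zero]
    · obtain ht | ht := lt_or_gt_of_ne ht
      · rw [invQPoch_of_neg q ht, zero_mul, mul_zero, mul_zero]
      · rw [invQPoch_of_neg q (n := (0 : ℕ) - t) (by lia), zero_mul, mul_zero]
  | succ M ih =>
    have hM : (1 : ℂ) - q ^ (M + 1 : ℤ) ≠ 0 := by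
      exact_mod_cast one_sub_pow_succ_ne_zero hq M
    have hshift := (Equiv.subRight (1 : ℤ)).hasSum_iff.mpr
      ((ih (c + 1)).mul_left (q ^ (M + 1 + c : ℤ)))
    have hexp (t : ℤ) : q ^ (M + 1 + c : ℤ) * q ^ ((t - 1) * (t + c)) =
        q ^ (t * (t + c)) * q ^ (M + 1 - t) := by
      rw [← zpow_add₀ hq0, ← zpow_add₀ hq0]
      ring_nf
    have hval : (1 - q ^ (M + 1 : ℤ)) * (invQPoch q (M + 1) * invQPoch q (M + 1 + c)) =
        invQPoch q M * invQPoch q (M + c) +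
          q ^ (M + 1 + c : ℤ) * (invQPoch q M * invQPoch q (M + (c + 1))) := by
      have h1 := one_sub_zpow_mul_invQPoch hq (M + 1)
      have h2 := one_sub_zpow_mul_invQPoch hq (M + 1 + c)
      rw [add_sub_cancel_right] at h1
      rw [show (M + 1 + c - 1 : ℤ) = M + c by ring] at h2
      rw [← mul_assoc, h1, ← h2, show (M + (c + 1) : ℤ) = M + 1 + c by ring]
      ring
    push_cast
    rw [← hasSum_mul_left_iff hM, hval]
    refine ((ih c).add hshift).congr_fun fun t => ?_
    simp only [Function.comp, Equiv.subRight_apply]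
    rw [show t - 1 + (c + 1) = t + c by ring, show (M : ℤ) - (t - 1) = M + 1 - t by ring,
      ← mul_assoc (q ^ (M + 1 + c : ℤ)), hexp]
    have hpascal := one_sub_zpow_mul_invQPoch_mul_invQPoch hq0 hq (M + 1) t
    rw [add_sub_cancel_right] at hpascal
    linear_combination q ^ (t * (t + c)) * invQPoch q (t + c) * hpascal

theorem hasSum_qVandermonde {q : ℂ} (hq0 : q ≠ 0) (hq : ‖q‖ < 1) (a b N : ℤ) :
    HasSum (fun s : ℤ => q ^ ((s - a) * (s - b)) *
        (invQPoch q (N - s) * (invQPoch q (s - a) * invQPoch q (s - b))))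
      (invQPoch q (N - a) * invQPoch q (N - b)) := by
  obtain hN | hN := lt_or_ge N a
  · rw [invQPoch_of_neg q (sub_neg.mpr hN), zero_mul]
    refine hasSum_zero.congr_fun fun s => ?_
    obtain hs | hs := lt_or_ge N s
    · rw [invQPoch_of_neg q (sub_neg.mpr hs), zero_mul, mul_zero]
    · rw [invQPoch_of_neg q (n := s - a) (by lia), zero_mul, mul_zero, mul_zero]
  · obtain ⟨M, rfl⟩ := Int.le.dest hN
    have h := (Equiv.subRight a).hasSum_iff.mpr (hasSum_qVandermonde_nat hq0 hq M (a - b))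
    rw [add_sub_cancel_left, show a + M - b = M + (a - b) by ring]
    refine h.congr_fun fun s => ?_
    simp only [Function.comp, Equiv.subRight_apply, sub_add_sub_cancel]
    rw [show a + M - s = M - (s - a) by ring]

theorem sum_range_qVandermonde {q : ℂ} (hq0 : q ≠ 0) (hq : ‖q‖ < 1) {e : ℕ} (he : e ≤ 1) (N : ℕ)
    (m : ℤ) :
    ∑ s ∈ range (N + 1), q ^ (s ^ 2 + e * s) * invQPoch q (N - s) *
        (invQPoch q (s - m) * invQPoch q (s + m + e)) =
      q ^ (m ^ 2 + e * m) * (invQPoch q (N - m) * invQPoch q (N + m + e)) := by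
  have hvand := (hasSum_qVandermonde hq0 hq m (-m - e) N).mul_left (q ^ (m ^ 2 + e * m))
  simp only [show ∀ x : ℤ, x - (-m - e) = x + m + e from fun x => by ring] at hvand
  have hnat := (Nat.cast_injective.hasSum_iff fun s hs => ?_).mpr hvand
  · refine (hasSum_sum_of_ne_finset_zero (L := .unconditional ℕ) fun s hs => ?_).unique
      (hnat.congr_fun fun s => ?_)
    · rw [invQPoch_of_neg q (n := N - s) (by grind), mul_zero, zero_mul]
    · have hexp : q ^ (m ^ 2 + e * m) * q ^ ((s - m : ℤ) * (s + m + e)) = q ^ (s ^ 2 + e * s) := by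
        rw [← zpow_add₀ hq0, ← zpow_natCast]
        push_cast
        ring_nf
      rw [Function.comp, ← hexp]
      ring
  · have hs : s < 0 := not_le.mp fun h => hs ⟨s.toNat, by simpa⟩
    obtain h | h : s - m < 0 ∨ s + m + e < 0 := by lia
    all_goals rw [invQPoch_of_neg q h]; ring

/-- Bailey's lemma, in the specialisation in which both parameters tend to infinity. -/
theorem sum_range_mul_baileySum {q : ℂ} (hq0 : q ≠ 0) (hq : ‖q‖ < 1) {e : ℕ} (he : e ≤ 1)
    (α : ℤ → ℂ) (N : ℕ) :
    ∑ s ∈ range (N + 1), q ^ (s ^ 2 + e * s) * invQPoch q (N - s) * baileySum q e α s =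
      baileySum q e (fun m => α m * q ^ (m ^ 2 + e * m)) N := by
  have h := hasSum_sum fun s (_ : s ∈ range (N + 1)) =>
    (hasSum_baileySum q e α s).mul_left (q ^ (s ^ 2 + e * s) * invQPoch q (N - s))
  refine h.unique ((hasSum_baileySum q e _ N).congr_fun fun m => ?_)
  rw [mul_assoc, ← sum_range_qVandermonde hq0 hq he, mul_sum]
  exact sum_congr rfl fun s _ => by ring

theorem baileySum_zero_eq_baileySum_one {q : ℂ} (hq0 : q ≠ 0) (hq : ‖q‖ < 1) {α : ℤ → ℂ}
    (hα : ∀ m, α (-1 - m) * q ^ (-1 - m) = -(α m * q ^ m)) (N : ℕ) :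
    baileySum q 0 α N = baileySum q 1 α N := by
  have hodd := hasSum_baileySum q 1 (fun m => α m * q ^ m) N
  have hzero : baileySum q 1 (fun m => α m * q ^ m) N = 0 := by
    refine self_eq_neg.mp (HasSum.unique ?_ hodd.neg)
    refine ((Equiv.subLeft (-1 : ℤ)).hasSum_iff.mpr hodd).congr_fun fun m => ?_
    simp only [Function.comp, Equiv.subLeft_apply, hα, Nat.cast_one]
    rw [show (N : ℤ) - (-1 - m) = N + m + 1 by ring, show (N : ℤ) + (-1 - m) + 1 = N - m by ring]
    ring
  have h := (hasSum_baileySum q 1 α N).sub (hodd.mul_left (q ^ (N + 1)))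
  rw [hzero, mul_zero, sub_zero] at h
  refine (hasSum_baileySum q 0 α N).unique (h.congr_fun fun m => ?_)
  have hpow : q ^ (N + m + 1 : ℤ) = q ^ (N + 1) * q ^ m := by
    rw [add_right_comm, zpow_add₀ hq0, ← zpow_natCast, Nat.cast_succ]
  have hstep := one_sub_zpow_mul_invQPoch hq (N + m + 1)
  rw [add_sub_cancel_right, hpow] at hstep
  rw [Nat.cast_zero, add_zero, Nat.cast_one, ← hstep]
  ring

theorem sum_range_mul_baileySum_thetaTerm {q : ℂ} (hq0 : q ≠ 0) (hq : ‖q‖ < 1) (b Q : ℂ) (N : ℕ) :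
    ∑ s ∈ range (N + 1), q ^ s ^ 2 * invQPoch q (N - s) * baileySum q 0 (thetaTerm b Q) s =
      baileySum q 0 (thetaTerm (b * q) (Q * q ^ 2)) N := by
  simpa only [zero_mul, add_zero, Nat.cast_zero, thetaTerm_mul_zpow_sq hq0] using
    sum_range_mul_baileySum hq0 hq zero_le_one (thetaTerm b Q) N

theorem baileySum_thetaTerm_zero_eq_one {b q : ℂ} (hb : b ≠ 0) (hq0 : q ≠ 0) (hq : ‖q‖ < 1) :
    baileySum q 0 (thetaTerm b (b * q)) = baileySum q 1 (thetaTerm b (b * q)) := by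
  refine funext (baileySum_zero_eq_baileySum_one hq0 hq fun m => ?_)
  rw [thetaTerm_mul_zpow, thetaTerm_mul_zpow, thetaTerm_neg_one_sub (mul_ne_zero hb hq0)]

theorem sum_range_mul_baileySum_thetaTerm_mul_self {b q : ℂ} (hb : b ≠ 0) (hq0 : q ≠ 0)
    (hq : ‖q‖ < 1) (N : ℕ) :
    ∑ s ∈ range (N + 1), q ^ (s ^ 2 + s) * invQPoch q (N - s) *
        baileySum q 0 (thetaTerm b (b * q)) s =
      baileySum q 0 (thetaTerm (b * q ^ 2) (b * q ^ 2 * q)) N := by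
  have h := sum_range_mul_baileySum hq0 hq le_rfl (thetaTerm b (b * q)) N
  simp only [Nat.cast_one, one_mul, zpow_add₀ hq0, ← mul_assoc, thetaTerm_mul_zpow_sq hq0,
    thetaTerm_mul_zpow] at h
  rw [baileySum_thetaTerm_zero_eq_one hb hq0 hq, h,
    baileySum_thetaTerm_zero_eq_one (mul_ne_zero hb (pow_ne_zero 2 hq0)) hq0 hq,
    show b * q * q = b * q ^ 2 by ring, show b * q * q ^ 2 = b * q ^ 2 * q by ring]

theorem baileySum_thetaTerm_one {q : ℂ} (hq0 : q ≠ 0) (hq : ‖q‖ < 1) (N : ℕ) :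
    baileySum q 0 (thetaTerm 1 q) N = if N = 0 then 1 else 0 := by
  rw [baileySum_thetaTerm one_ne_zero hq0 hq]
  split_ifs with h
  · simp [h, qPoch_zero]
  · rw [show qPoch 1 q N = 0 from prod_eq_zero (i := 0) (by grind) (by simp)]
    simp

theorem baileySum_thetaTerm_sq_cube {q : ℂ} (hq0 : q ≠ 0) (hq : ‖q‖ < 1) (N : ℕ) :
    baileySum q 0 (thetaTerm (q ^ 2) (q ^ 3)) N = invQPoch q N := by
  have h := sum_range_mul_baileySum_thetaTerm_mul_self one_ne_zero hq0 hq N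
  simp only [one_mul, ← pow_succ, baileySum_thetaTerm_one hq0 hq] at h
  simpa using h.symm

theorem hasSum_pi_succ {M : Type*} [AddCommMonoid M] [TopologicalSpace M] [ContinuousAdd M]
    {k : ℕ} {F : ℕ → (Fin k → ℕ) → M} {g : ℕ → M} {N : ℕ}
    (hlt : ∀ s t, s < ∑ l, t l → F s t = 0) (hgt : ∀ s t, N < s → F s t = 0)
    (hF : ∀ s, HasSum (F s) (g s)) :
    HasSum (fun n : Fin (k + 1) → ℕ => F (∑ l, n l) (Fin.tail n)) (∑ s ∈ range (N + 1), g s) := by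
  have hinj : Function.Injective fun n : Fin (k + 1) → ℕ => (∑ l, n l, Fin.tail n) := by
    intro n n' h
    rw [Prod.mk.injEq, Fin.sum_univ_succ, Fin.sum_univ_succ] at h
    have htail : ∀ l : Fin k, n l.succ = n' l.succ := congrFun h.2
    refine funext (Fin.cases ?_ htail)
    simpa only [htail, add_left_inj] using h.1
  have hslice (s : ℕ) : HasSum (fun p : ℕ × (Fin k → ℕ) => if p.1 = s then F p.1 p.2 else 0)
      (g s) := by
    refine ((Prod.mk_right_injective s).hasSum_iff fun p hp => if_neg ?_).mp
      ((hF s).congr_fun fun t => if_pos rfl)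
    rintro rfl
    exact hp ⟨p.2, rfl⟩
  have hprod : HasSum (fun p : ℕ × (Fin k → ℕ) => F p.1 p.2) (∑ s ∈ range (N + 1), g s) := by
    refine (hasSum_sum fun s _ => hslice s).congr_fun fun p => ?_
    rw [sum_ite_eq]
    split_ifs with hp
    · rfl
    · exact hgt _ _ (by simpa using hp)
  refine (hinj.hasSum_iff fun ⟨s, t⟩ hst => hlt s t (not_le.mp fun hle => hst ?_)).mpr hprod
  refine ⟨consVec (s - ∑ l, t l) t, Prod.ext ?_ rfl⟩
  simp only [consVec, Fin.sum_univ_succ, Fin.cons_zero, Fin.cons_succ, Nat.sub_add_cancel hle]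

theorem partialN_one {k : ℕ} (n : Fin k → ℕ) : partialN n 1 = ∑ l, n l := by
  simp [partialN]

theorem partialN_tail {k : ℕ} (n : Fin (k + 1) → ℕ) (j : ℕ) :
    partialN (Fin.tail n) (j + 1) = partialN n (j + 2) := by
  simp [partialN, Fin.tail, sum_filter, Fin.sum_univ_succ]

theorem sum_Icc_partialN_tail {k : ℕ} (n : Fin (k + 1) → ℕ) (f : ℕ → ℕ) (i : ℕ) :
    ∑ j ∈ Icc (i + 1) k, f (partialN (Fin.tail n) j) =
      ∑ j ∈ Icc (i + 2) (k + 1), f (partialN n j) := by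
  rw [show Icc (i + 2) (k + 1) = (Icc (i + 1) k).map (addRightEmbedding 1) from
    (map_add_right_Icc (i + 1) k 1).symm, sum_map]
  refine sum_congr rfl fun j hj => ?_
  obtain ⟨j, rfl⟩ := Nat.exists_eq_add_of_le' (i.succ_pos.trans_le (mem_Icc.mp hj).1)
  exact congrArg f (partialN_tail n j)

theorem sum_Icc_one_partialN {k : ℕ} (n : Fin (k + 1) → ℕ) (f : ℕ → ℕ) :
    ∑ j ∈ Icc 1 (k + 1), f (partialN n j) =
      f (∑ l, n l) + ∑ j ∈ Icc 1 k, f (partialN (Fin.tail n) j) := by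
  rw [← add_sum_Ioc_eq_sum_Icc (Nat.le_add_left 1 k), partialN_one, sum_Icc_partialN_tail n f 0]
  rfl

theorem agExponent_one {k : ℕ} (n : Fin (k + 1) → ℕ) :
    agExponent 1 n = (∑ l, n l) ^ 2 + ∑ l, n l + agExponent 1 (Fin.tail n) := by
  rw [agExponent, agExponent, sum_Icc_one_partialN n (· ^ 2), sum_Icc_one_partialN n fun x => x]
  ring

theorem agExponent_add_two {k : ℕ} (i : ℕ) (n : Fin (k + 1) → ℕ) :
    agExponent (i + 2) n = (∑ l, n l) ^ 2 + agExponent (i + 1) (Fin.tail n) := by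
  rw [agExponent, agExponent, sum_Icc_one_partialN n (· ^ 2), ← sum_Icc_partialN_tail n fun x => x,
    add_assoc]

theorem sq_sum_le_agExponent {k : ℕ} (i : ℕ) (n : Fin k → ℕ) :
    (∑ l, n l) ^ 2 ≤ agExponent i n := by
  cases k with
  | zero => simp
  | succ k =>
    rw [agExponent, sum_Icc_one_partialN n (· ^ 2), add_assoc]
    exact Nat.le_add_right _ _

/-- The general term `q^(N_1² + ⋯ + N_k² + N_i + ⋯ + N_k) / ((q;q)_{n_1} ⋯ (q;q)_{n_k})` of the
Andrews–Gordon series. -/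
noncomputable def agTerm (q : ℂ) {k : ℕ} (i : ℕ) (n : Fin k → ℕ) : ℂ :=
  q ^ agExponent i n * ∏ l, (qPoch q q (n l))⁻¹

theorem hasSum_agTerm_mul_invQPoch_succ {q : ℂ} {k i j : ℕ} (c : ℕ → ℕ)
    (hc : ∀ n : Fin (k + 1) → ℕ, agExponent j n = c (∑ l, n l) + agExponent i (Fin.tail n))
    {g : ℕ → ℂ}
    (hg : ∀ N : ℕ, HasSum (fun n : Fin k → ℕ => agTerm q i n * invQPoch q (N - ∑ l, n l)) (g N))
    (N : ℕ) :
    HasSum (fun n : Fin (k + 1) → ℕ => agTerm q j n * invQPoch q (N - ∑ l, n l))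
      (∑ s ∈ range (N + 1), q ^ c s * invQPoch q (N - s) * g s) := by
  have h := hasSum_pi_succ (N := N) (fun s t hs => ?_) (fun s t hs => ?_)
    fun s => (hg s).mul_left (q ^ c s * invQPoch q (N - s))
  · refine h.congr_fun fun n => ?_
    have hhead : ((∑ l, n l : ℕ) : ℤ) - (∑ l, Fin.tail n l : ℕ) = (n 0 : ℤ) := by
      simp [Fin.sum_univ_succ, Fin.tail]
    rw [hhead, invQPoch_natCast, agTerm, agTerm, hc, pow_add, Fin.prod_univ_succ]
    simp only [Fin.tail]
    ring
  · rw [invQPoch_of_neg q (sub_neg.mpr (Nat.cast_lt.mpr hs)), mul_zero, mul_zero]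
  · rw [invQPoch_of_neg q (by lia), mul_zero, zero_mul]

theorem hasSum_agTerm_mul_invQPoch {q : ℂ} (hq0 : q ≠ 0) (hq : ‖q‖ < 1) {k i : ℕ} (hi : 1 ≤ i)
    (hik : i ≤ k + 1) (N : ℕ) :
    HasSum (fun n : Fin k → ℕ => agTerm q i n * invQPoch q (N - ∑ l, n l))
      (baileySum q 0 (thetaTerm (q ^ (2 * k + 3 - i)) (q ^ (2 * k + 3))) N) := by
  induction k generalizing i N with
  | zero =>
    obtain rfl : i = 1 := le_antisymm hik hi
    rw [baileySum_thetaTerm_sq_cube hq0 hq]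
    convert hasSum_unique fun n : Fin 0 → ℕ =>
      agTerm q 1 n * invQPoch q (N - (∑ l, n l : ℕ)) using 1
    simp [agTerm, agExponent]
  | succ k ih =>
    obtain _ | _ | i := i
    · contradiction
    · have h := hasSum_agTerm_mul_invQPoch_succ (fun s => s ^ 2 + s) agExponent_one
        (ih le_rfl (Nat.le_add_left 1 k)) N
      have hb : q ^ (2 * k + 3) = q ^ (2 * k + 3 - 1) * q := (pow_succ _ _).symm
      rw [hb, sum_range_mul_baileySum_thetaTerm_mul_self (pow_ne_zero _ hq0) hq0 hq, ← pow_add,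
        ← pow_succ] at h
      exact h
    · have h := hasSum_agTerm_mul_invQPoch_succ (· ^ 2) (agExponent_add_two i)
        (ih i.succ_pos (by lia)) N
      rw [sum_range_mul_baileySum_thetaTerm hq0 hq, ← pow_succ, ← pow_add,
        show 2 * k + 3 - (i + 1) + 1 = 2 * (k + 1) + 3 - (i + 1 + 1) by lia] at h
      exact h

theorem summable_prod_pi {X : Type*} {g : X → ℝ} (hg : Summable g) (hg0 : 0 ≤ g) (k : ℕ) :
    Summable fun n : Fin k → X => ∏ l, g (n l) := by
  induction k with
  | zero => exact (hasSum_unique _).summable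
  | succ k ih =>
    rw [← (Fin.consEquiv fun _ : Fin (k + 1) => X).summable_iff]
    refine (hg.mul_of_nonneg ih hg0 fun n => prod_nonneg fun l _ => hg0 _).congr fun p => ?_
    simp [Fin.consEquiv, Fin.prod_univ_succ]

theorem summable_agTerm {q : ℂ} (hq : ‖q‖ < 1) (k i : ℕ) :
    Summable fun n : Fin k → ℕ => agTerm q i n := by
  obtain ⟨C, hC⟩ := exists_norm_inv_qPoch_le hq hq
  have hgeom : Summable fun n : ℕ => ‖q‖ ^ n * ‖(qPoch q q n)⁻¹‖ :=
    .of_nonneg_of_le (fun n => by positivity)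
      (fun n => mul_le_mul_of_nonneg_left (hC n) (by positivity))
      ((summable_geometric_of_lt_one (norm_nonneg q) hq).mul_right C)
  refine .of_norm_bounded (summable_prod_pi hgeom (fun n => by positivity) k) fun n => ?_
  rw [agTerm, norm_mul, norm_pow, norm_prod, prod_mul_distrib, prod_pow_eq_pow_sum]
  refine mul_le_mul_of_nonneg_right (pow_le_pow_of_le_one (norm_nonneg q) hq.le ?_)
    (prod_nonneg fun _ _ => norm_nonneg _)
  exact (Nat.le_self_pow two_ne_zero _).trans (sq_sum_le_agExponent i n)

theorem qPochInf_zero_left (q : ℂ) : qPochInf 0 q = 1 := by simp [qPochInf]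

/-- The triple product on the right-hand side of the Andrews–Gordon identity of modulus
`2k + 3`. -/
noncomputable def agProduct (q : ℂ) (k i : ℕ) : ℂ :=
  qPochInf₃ (q ^ i) (q ^ (2 * k + 3 - i)) (q ^ (2 * k + 3)) (q ^ (2 * k + 3))

theorem agProduct_pow_two (q : ℂ) (k i : ℕ) :
    agProduct (q ^ 2) k i = qPochInf₃ (q ^ (2 * i)) (q ^ (4 * k + 6 - 2 * i)) (q ^ (4 * k + 6))
      (q ^ (4 * k + 6)) := by
  rw [agProduct, ← pow_mul, ← pow_mul, ← pow_mul, show 2 * (2 * k + 3) = 4 * k + 6 by ring,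
    show 2 * (2 * k + 3 - i) = 4 * k + 6 - 2 * i by lia]

theorem agProduct_pow_four (q : ℂ) (k i : ℕ) :
    agProduct (q ^ 4) k i = qPochInf₃ (q ^ (4 * i)) (q ^ (8 * k + 12 - 4 * i))
      (q ^ (8 * k + 12)) (q ^ (8 * k + 12)) := by
  rw [agProduct, ← pow_mul, ← pow_mul, ← pow_mul, show 4 * (2 * k + 3) = 8 * k + 12 by ring,
    show 4 * (2 * k + 3 - i) = 8 * k + 12 - 4 * i by lia]

theorem hasSum_agTerm_zero {k i : ℕ} (hi : 1 ≤ i) (hik : i ≤ k + 1) :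
    HasSum (fun n : Fin k → ℕ => agTerm 0 i n) (agProduct 0 k i / qPochInf 0 0) := by
  have hprod : agProduct 0 k i / qPochInf 0 0 = 1 := by
    rw [agProduct, zero_pow (by lia), zero_pow (by lia), zero_pow (by lia), qPochInf₃,
      qPochInf_zero_left]
    norm_num
  rw [hprod]
  convert hasSum_single (0 : Fin k → ℕ) fun n hn => ?_ using 1
  · simp [agTerm, agExponent, partialN, qPoch_zero]
  · have hsum : ∑ l, n l ≠ 0 := fun h => hn (funext fun l => sum_eq_zero_iff.mp h l (mem_univ l))
    have hpos := (Nat.pow_pos (Nat.pos_of_ne_zero hsum)).trans_le (sq_sum_le_agExponent i n)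
    rw [agTerm, zero_pow hpos.ne', zero_mul]

theorem hasSum_agTerm {q : ℂ} (hq : ‖q‖ < 1) {k i : ℕ} (hi : 1 ≤ i) (hik : i ≤ k + 1) :
    HasSum (fun n : Fin k → ℕ => agTerm q i n) (agProduct q k i / qPochInf q q) := by
  obtain rfl | hq0 := eq_or_ne q 0
  · exact hasSum_agTerm_zero hi hik
  have hP := inv_ne_zero (qPochInf_ne_zero hq hq)
  have hsum := summable_agTerm hq k i
  obtain ⟨C, hC⟩ := exists_norm_invQPoch_le hq
  have hmulti := tendsto_tsum_mul_of_bounded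
    (K := fun (N : ℕ) (n : Fin k → ℕ) => invQPoch q (N - (∑ l, n l : ℕ))) hsum.norm
    (fun N n => hC _)
    fun n => tendsto_invQPoch_natCast_add hq (-(∑ l, n l : ℕ))
  simp only [(hasSum_agTerm_mul_invQPoch hq0 hq hi hik _).tsum_eq] at hmulti
  have hQ0 := pow_ne_zero (2 * k + 3) hq0
  have hQ := norm_pow_lt_one hq (n := 2 * k + 3) (by lia)
  have htheta := tendsto_baileySum hq 0 (summable_thetaTerm (q ^ (2 * k + 3 - i)) hQ)
  have hdiv : q ^ (2 * k + 3) / q ^ (2 * k + 3 - i) = q ^ i := by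
    rw [div_eq_iff (pow_ne_zero _ hq0), ← pow_add, Nat.add_sub_cancel' (by lia)]
  have h := tendsto_nhds_unique hmulti htheta
  rw [← mul_assoc, mul_left_inj' hP, tsum_thetaTerm (pow_ne_zero _ hq0) hQ0 hQ, hdiv, qPochInf₃,
    mul_comm (qPochInf _ _), ← qPochInf₃, ← agProduct, ← div_eq_mul_inv] at h
  exact h ▸ hsum.hasSum

theorem hasSum_ag_cons {q : ℂ} (hq : ‖q‖ < 1) {r i : ℕ} (hi : 1 ≤ i) (hir : i ≤ r + 2) :
    HasSum (fun x : ℕ × (Fin r → ℕ) => (qPoch q q x.1)⁻¹ *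
      (q ^ agExponent i (consVec x.1 x.2) * ∏ l, (qPoch q q (x.2 l))⁻¹))
      (agProduct q (r + 1) i / qPochInf q q) := by
  have h := (Fin.consEquiv fun _ : Fin (r + 1) => ℕ).hasSum_iff.mpr (hasSum_agTerm hq hi hir)
  refine h.congr_fun fun x => ?_
  simp only [Function.comp, Fin.consEquiv, Equiv.coe_fn_mk, agTerm, Fin.prod_univ_succ,
    Fin.cons_zero, Fin.cons_succ, consVec]
  ring

theorem hasSum_ag_snoc {q : ℂ} (hq : ‖q‖ < 1) {r i : ℕ} (hi : 1 ≤ i) (hir : i ≤ r + 2) :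
    HasSum (fun x : ℕ × (Fin r → ℕ) => (qPoch q q x.1)⁻¹ *
      (q ^ agExponent i (snocVec x.2 x.1) * ∏ l, (qPoch q q (x.2 l))⁻¹))
      (agProduct q (r + 1) i / qPochInf q q) := by
  have h := (Fin.snocEquiv fun _ : Fin (r + 1) => ℕ).hasSum_iff.mpr (hasSum_agTerm hq hi hir)
  refine h.congr_fun fun x => ?_
  simp only [Function.comp, Fin.snocEquiv, Equiv.coe_fn_mk, agTerm, Fin.prod_univ_castSucc,
    Fin.snoc_last, Fin.snoc_castSucc, snocVec]
  ring

theorem hasSum_sigma_of_norm_le {E Y I : Type*} [NormedAddCommGroup E] [CompleteSpace E]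
    {φ : Y → Type*} {c : ∀ y, φ y → E} {d : Y → E} {u : Y → ℝ} {ι : ∀ y, φ y → I} {g : I → ℝ}
    {s : E} (hι : ∀ y, (ι y).Injective) (hg : Summable g)
    (hg0 : 0 ≤ g) (hu : Summable u) (hu0 : 0 ≤ u) (hle : ∀ y x, ‖c y x‖ ≤ g (ι y x) * u y)
    (hc : ∀ y, HasSum (c y) (d y)) (hd : HasSum d s) :
    HasSum (fun p : Σ y, φ y => c p.1 p.2) s := by
  have hinj : Function.Injective fun p : Σ y, φ y => (ι p.1 p.2, p.1) := by
    rintro ⟨y, x⟩ ⟨y', x'⟩ h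
    obtain ⟨hx, rfl⟩ := Prod.mk.inj h
    exact congrArg _ (hι y hx)
  have hprod := hg.mul_of_nonneg hu hg0 hu0
  exact hd.sigma_of_hasSum hc (.of_norm_bounded (hprod.comp_injective hinj) fun p => hle p.1 p.2)

theorem exists_norm_inv_qPoch_mul_inv_qPoch_le {p q r : ℂ} (hp : ‖p‖ < 1) (hq : ‖q‖ < 1)
    (hr : ‖r‖ < 1) :
    ∃ C : ℝ, 0 ≤ C ∧ ∀ a b n,
      ‖(qPoch p p a)⁻¹ * (qPoch q q b)⁻¹‖ ≤ C * ‖(qPoch r r n)⁻¹‖ := by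
  obtain ⟨A, hA⟩ := exists_norm_inv_qPoch_le hp hp
  obtain ⟨B, hB⟩ := exists_norm_inv_qPoch_le hq hq
  obtain ⟨D, hD⟩ := exists_norm_qPoch_le r hr
  have hA0 := (norm_nonneg _).trans (hA 0)
  have hB0 := (norm_nonneg _).trans (hB 0)
  have hD0 := (norm_nonneg _).trans (hD 0)
  refine ⟨A * B * D, by positivity, fun a b n => ?_⟩
  have hone : 1 ≤ D * ‖(qPoch r r n)⁻¹‖ := by
    rw [norm_inv, ← div_eq_mul_inv, one_le_div (norm_pos_iff.mpr (qPoch_ne_zero hr hr n))]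
    exact hD n
  calc ‖(qPoch p p a)⁻¹ * (qPoch q q b)⁻¹‖ ≤ A * B := by
        rw [norm_mul]
        exact mul_le_mul (hA a) (hB b) (norm_nonneg _) hA0
    _ ≤ A * B * (D * ‖(qPoch r r n)⁻¹‖) := le_mul_of_one_le_right (by positivity) hone
    _ = _ := by ring

theorem hasSum_euler_qPoch {q : ℂ} (hq : ‖q‖ < 1) (n : ℕ) :
    HasSum (fun m : ℕ => q ^ ((m + 1).choose 2 + m * n) * ((qPoch q q m)⁻¹ * (qPoch q q n)⁻¹))
      (qPochInf (-q) q * (qPoch (q ^ 2) (q ^ 2) n)⁻¹) := by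
  have h0 : qPoch (-q) q n ≠ 0 := qPoch_ne_zero (by rwa [norm_neg]) hq n
  rw [← qPoch_mul_qPochInf (-q) hq n, ← qPoch_mul_qPoch_neg, mul_inv, mul_left_comm,
    mul_right_comm, mul_inv_cancel₀ h0, one_mul]
  refine ((hasSum_euler hq (-q * q ^ n)).mul_left _).congr_fun fun m => ?_
  rw [Nat.choose_succ_succ' m 1, Nat.choose_one_right, pow_add, pow_add, pow_mul' q m n,
    neg_mul, neg_neg, mul_pow]
  ring

theorem qPochInf_neg_mul_div {q : ℂ} (hq : ‖q‖ < 1) (s : ℂ) :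
    qPochInf (-q) q * (s / qPochInf (q ^ 2) (q ^ 2)) = s / qPochInf q q := by
  rw [← qPochInf_mul_qPochInf_neg hq, mul_div, mul_comm (qPochInf q q),
    mul_div_mul_left _ _ (qPochInf_ne_zero (by rwa [norm_neg]) hq)]

theorem hasSum_euler_mul {q : ℂ} (hq : ‖q‖ < 1) {Z : Type*} (ν : Z → ℕ) {w : Z → ℂ} {s : ℂ}
    (h : HasSum (fun z => (qPoch (q ^ 2) (q ^ 2) (ν z))⁻¹ * w z) s) :
    HasSum (fun p : ℕ × Z => q ^ ((p.1 + 1).choose 2 + p.1 * ν p.2) *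
      ((qPoch q q p.1)⁻¹ * (qPoch q q (ν p.2))⁻¹) * w p.2) (qPochInf (-q) q * s) := by
  obtain ⟨C, hC0, hC⟩ :=
    exists_norm_inv_qPoch_mul_inv_qPoch_le hq hq (norm_pow_lt_one hq two_ne_zero)
  have hsigma := hasSum_sigma_of_norm_le (φ := fun _ : Z => ℕ)
    (c := fun z m => q ^ ((m + 1).choose 2 + m * ν z) *
      ((qPoch q q m)⁻¹ * (qPoch q q (ν z))⁻¹) * w z) (ι := fun _ m => m)
    (fun _ => Function.injective_id) ((summable_pow_mul_pow_choose_two 1 hq).norm.mul_right C)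
    (fun m => by positivity) h.summable.norm (fun z => norm_nonneg _) (fun z m => ?_)
    (fun z => (hasSum_euler_qPoch hq (ν z)).mul_right (w z))
    ((h.mul_left (qPochInf (-q) q)).congr_fun fun z => mul_assoc _ _ _)
  · exact ((Equiv.sigmaEquivProd Z ℕ).trans (Equiv.prodComm Z ℕ)).symm.hasSum_iff.mpr hsigma
  · have hexp : m.choose 2 ≤ (m + 1).choose 2 + m * ν z :=
      (Nat.choose_le_succ m 2).trans (Nat.le_add_right _ _)
    rw [norm_mul, norm_mul, norm_mul _ (w z), ← mul_assoc, mul_assoc _ C, one_pow, one_mul,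
      norm_pow, norm_pow]
    gcongr ?_ * ?_ * _
    · exact pow_le_pow_of_le_one (norm_nonneg q) hq.le hexp
    · exact hC m (ν z) (ν z)

theorem hasSum_coeff_mul {F G : ℂ⟦X⟧} {I Z : Type*} {ι : ℕ × ℕ → I} {g : I → ℝ}
    (hι : Function.Injective fun p => (ι p, p.1 + p.2)) (hg : Summable g) (hg0 : 0 ≤ g)
    (hle : ∀ p : ℕ × ℕ, ‖coeff p.1 F * coeff p.2 G‖ ≤ g (ι p) * ‖coeff (p.1 + p.2) (F * G)‖)
    {w : ℕ × Z → ℂ} {s : ℂ} (h : HasSum (fun p : ℕ × Z => coeff p.1 (F * G) * w p) s) :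
    HasSum (fun p : ℕ × ℕ × Z => coeff p.1 F * coeff p.2.1 G * w (p.1 + p.2.1, p.2.2)) s := by
  have hsigma := hasSum_sigma_of_norm_le (φ := fun p : ℕ × Z => antidiagonal p.1)
    (c := fun p x => coeff x.1.1 F * coeff x.1.2 G * w p) (ι := fun p x => ι x) ?_ hg hg0
    h.summable.norm (fun p => norm_nonneg _) ?_ ?_ h
  · let e : ℕ × ℕ × Z ≃ Σ p : ℕ × Z, antidiagonal p.1 :=
      { toFun p := ⟨(p.1 + p.2.1, p.2.2), (p.1, p.2.1), by simp⟩
        invFun x := (x.2.1.1, x.2.1.2, x.1.2)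
        left_inv p := rfl
        right_inv := by
          rintro ⟨⟨n, z⟩, ⟨a, b⟩, hab⟩
          obtain rfl : a + b = n := mem_antidiagonal.mp hab
          rfl }
    exact e.hasSum_iff.mpr hsigma
  · rintro ⟨n, z⟩ ⟨x, hx⟩ ⟨y, hy⟩ hxy
    have hsum := (mem_antidiagonal.mp hx).trans (mem_antidiagonal.mp hy).symm
    exact Subtype.ext (hι (Prod.ext hxy hsum))
  · rintro ⟨n, z⟩ ⟨x, hx⟩
    obtain rfl : x.1 + x.2 = n := mem_antidiagonal.mp hx
    rw [norm_mul, norm_mul (coeff _ (F * G)), ← mul_assoc]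
    exact mul_le_mul_of_nonneg_right (hle x) (norm_nonneg _)
  · rintro ⟨n, z⟩
    rw [coeff_mul]
    exact (Finset.hasSum (antidiagonal n) fun x => coeff x.1 F * coeff x.2 G).mul_right _

theorem hasSum_split_add_two_mul {q : ℂ} (hq : ‖q‖ < 1) {Z : Type*} {w : ℕ × Z → ℂ} {s : ℂ}
    (h : HasSum (fun p : ℕ × Z => (qPoch q q p.1)⁻¹ * w p) s) :
    HasSum (fun p : ℕ × ℕ × Z => q ^ p.1.choose 2 *
      ((qPoch q q p.1)⁻¹ * (qPoch (q ^ 2) (q ^ 2) p.2.1)⁻¹) * w (p.1 + 2 * p.2.1, p.2.2)) s := by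
  obtain ⟨C, hC0, hC⟩ :=
    exists_norm_inv_qPoch_mul_inv_qPoch_le hq (norm_pow_lt_one hq two_ne_zero) hq
  have hcoeff (b : ℕ) : coeff (2 * b) (expand 2 two_ne_zero (invEulerSeries (q ^ 2))) =
      (qPoch (q ^ 2) (q ^ 2) b)⁻¹ := by
    rw [coeff_expand_mul, coeff_invEulerSeries]
  have hexpand := hasSum_coeff_mul (F := eulerSeries q)
    (G := expand 2 two_ne_zero (invEulerSeries (q ^ 2))) (ι := Prod.fst) (w := w)
    (g := fun a => ‖1 ^ a * q ^ a.choose 2‖ * C) (s := s) (fun p p' hp => ?_)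
    ((summable_pow_mul_pow_choose_two 1 hq).norm.mul_right C) (fun a => by positivity)
    (fun p => ?_) ?_
  · have hinj : Function.Injective fun p : ℕ × ℕ × Z => (p.1, 2 * p.2.1, p.2.2) := by
      rintro ⟨a, b, z⟩ ⟨a', b', z'⟩ hp
      simpa using hp
    refine ((hinj.hasSum_iff fun p hp => ?_).mpr hexpand).congr_fun fun p => ?_
    · rw [coeff_expand, if_neg, mul_zero, zero_mul]
      rintro ⟨b, hb⟩
      exact hp ⟨(p.1, b, p.2.2), by simp [← hb]⟩
    · simp only [Function.comp, hcoeff, coeff_eulerSeries, mul_assoc]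
  · rw [Prod.mk.injEq] at hp
    exact Prod.ext hp.1 (by lia)
  · rw [eulerSeries_mul_expand_invEulerSeries hq, coeff_expand, coeff_invEulerSeries,
      coeff_invEulerSeries]
    split_ifs with h2
    · rw [coeff_eulerSeries, mul_assoc, norm_mul, one_pow, one_mul, mul_assoc]
      exact mul_le_mul_of_nonneg_left (hC _ _ _) (norm_nonneg _)
    · rw [mul_zero, norm_zero]
      positivity
  · simpa only [eulerSeries_mul_expand_invEulerSeries hq, coeff_invEulerSeries] using h

theorem ringChoose_two_nonneg (m : ℤ) : 0 ≤ Ring.choose m 2 := by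
  linarith [two_mul_ringChoose_two m, Int.le_self_sq m]

theorem two_mul_choose_two_add_two_mul_choose_two_add (a b : ℕ) :
    ((2 * a.choose 2 + 2 * b.choose 2 + b : ℕ) : ℤ) =
      (a + b).choose 2 + Ring.choose (a - b : ℤ) 2 := by
  have ha := two_mul_ringChoose_two a
  have hb := two_mul_ringChoose_two b
  have hab := two_mul_ringChoose_two (a + b : ℕ)
  rw [Ring.choose_natCast] at ha hb hab
  push_cast at ha hb hab ⊢
  linarith [two_mul_ringChoose_two (a - b : ℤ)]

theorem hasSum_split_add {q : ℂ} (hq : ‖q‖ < 1) {Z : Type*} {w : ℕ × Z → ℂ} {s : ℂ}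
    (h : HasSum (fun p : ℕ × Z => q ^ p.1.choose 2 * (qPoch q q p.1)⁻¹ * w p) s) :
    HasSum (fun p : ℕ × ℕ × Z => q ^ (2 * p.1.choose 2 + 2 * p.2.1.choose 2 + p.2.1) *
      ((qPoch (q ^ 2) (q ^ 2) p.1)⁻¹ * (qPoch (q ^ 2) (q ^ 2) p.2.1)⁻¹) *
        w (p.1 + p.2.1, p.2.2)) s := by
  have hq2 := norm_pow_lt_one hq two_ne_zero
  obtain ⟨C, hC0, hC⟩ := exists_norm_inv_qPoch_mul_inv_qPoch_le hq2 hq2 hq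
  have hcoeff (a b : ℕ) :
      coeff a (eulerSeries (q ^ 2)) * coeff b (rescale q (eulerSeries (q ^ 2))) =
        q ^ (2 * a.choose 2 + 2 * b.choose 2 + b) *
          ((qPoch (q ^ 2) (q ^ 2) a)⁻¹ * (qPoch (q ^ 2) (q ^ 2) b)⁻¹) := by
    rw [coeff_rescale, coeff_eulerSeries, coeff_eulerSeries]
    ring
  have hsplit := hasSum_coeff_mul (F := eulerSeries (q ^ 2))
    (G := rescale q (eulerSeries (q ^ 2))) (ι := fun p => (p.1 - p.2 : ℤ)) (w := w)
    (g := fun m => ‖q ^ Ring.choose m 2‖ * C) (s := s) (fun p p' hp => ?_)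
    (.mul_right C ?_) (fun a => by positivity) (fun p => ?_) ?_
  · simpa only [hcoeff] using hsplit
  · simp only [Prod.mk.injEq] at hp
    exact Prod.ext (by lia) (by lia)
  · simpa [thetaTerm] using (summable_thetaTerm (-1) hq).norm
  · obtain ⟨e, he⟩ := Int.eq_ofNat_of_zero_le (ringChoose_two_nonneg (p.1 - p.2))
    have hexp := two_mul_choose_two_add_two_mul_choose_two_add p.1 p.2
    rw [he, ← Nat.cast_add, Nat.cast_inj] at hexp
    rw [eulerSeries_sq_mul_rescale_eulerSeries_sq hq, hcoeff, coeff_eulerSeries, hexp, he,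
      zpow_natCast, add_comm, pow_add, mul_assoc, norm_mul, norm_mul,
      norm_mul (q ^ (p.1 + p.2).choose 2), mul_assoc, mul_left_comm C]
    gcongr
    exact hC _ _ _
  · simpa only [eulerSeries_sq_mul_rescale_eulerSeries_sq hq, coeff_eulerSeries] using h

/-- Exchange of the first two summation variables, used to reindex multiple series. -/
def swapFirstTwo (α β γ : Type*) : α × β × γ ≃ β × α × γ :=
  ⟨fun x => (x.2.1, x.1, x.2.2), fun y => (y.2.1, y.1, y.2.2), fun _ => rfl, fun _ => rfl⟩

theorem hasSum_euler_ag_cons {q : ℂ} (hq : ‖q‖ < 1) {r i : ℕ} (hi : 1 ≤ i) (hir : i ≤ r + 2) :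
    HasSum (fun ((m, n₁, t) : ℕ × ℕ × (Fin r → ℕ)) =>
        q ^ ((m + 1).choose 2 + m * n₁ + 2 * agExponent i (consVec n₁ t)) /
          (qPoch q q m * qPoch q q n₁ * ∏ l, qPoch (q ^ 2) (q ^ 2) (t l)))
      (agProduct (q ^ 2) (r + 1) i / qPochInf q q) := by
  have h := hasSum_euler_mul hq Prod.fst (hasSum_ag_cons (norm_pow_lt_one hq two_ne_zero) hi hir)
  rw [qPochInf_neg_mul_div hq] at h
  refine h.congr_fun fun x => ?_
  simp only [pow_add, pow_mul, div_eq_mul_inv, mul_inv, prod_inv_distrib]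
  ring

theorem hasSum_euler_ag_snoc {q : ℂ} (hq : ‖q‖ < 1) {r i : ℕ} (hi : 1 ≤ i) (hir : i ≤ r + 2) :
    HasSum (fun ((m, t, nk) : ℕ × (Fin r → ℕ) × ℕ) =>
        q ^ ((m + 1).choose 2 + m * nk + 2 * agExponent i (snocVec t nk)) /
          (qPoch q q m * (∏ l, qPoch (q ^ 2) (q ^ 2) (t l)) * qPoch q q nk))
      (agProduct (q ^ 2) (r + 1) i / qPochInf q q) := by
  have h := hasSum_euler_mul hq Prod.snd ((Equiv.prodComm _ _).hasSum_iff.mpr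
    (hasSum_ag_snoc (norm_pow_lt_one hq two_ne_zero) hi hir))
  rw [qPochInf_neg_mul_div hq] at h
  refine h.congr_fun fun x => ?_
  simp only [Equiv.prodComm_apply, Prod.fst_swap, Prod.snd_swap, pow_add, pow_mul, div_eq_mul_inv,
    mul_inv, prod_inv_distrib]
  ring

theorem hasSum_euler_euler_ag_cons {q : ℂ} (hq : ‖q‖ < 1) {r i : ℕ} (hi : 1 ≤ i)
    (hir : i ≤ r + 2) :
    HasSum (fun ((m₁, m₂, n₁, t) : ℕ × ℕ × ℕ × (Fin r → ℕ)) =>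
        q ^ ((m₁ + 1).choose 2 + m₁ * m₂ + 2 * (m₂ + 1).choose 2 + 2 * m₂ * n₁ +
            4 * agExponent i (consVec n₁ t)) /
          (qPoch q q m₁ * qPoch q q m₂ * qPoch (q ^ 2) (q ^ 2) n₁ *
            ∏ l, qPoch (q ^ 4) (q ^ 4) (t l)))
      (agProduct (q ^ 4) (r + 1) i / qPochInf q q) := by
  have hag := hasSum_euler_ag_cons (norm_pow_lt_one hq two_ne_zero) hi hir
  simp only [← pow_mul (n := 2), Nat.reduceMul] at hag
  have h := hasSum_euler_mul hq Prod.fst (w := fun x : ℕ × ℕ × (Fin r → ℕ) =>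
    (q ^ 2) ^ ((x.1 + 1).choose 2 + x.1 * x.2.1 + 2 * agExponent i (consVec x.2.1 x.2.2)) *
      ((qPoch (q ^ 2) (q ^ 2) x.2.1)⁻¹ * (∏ l, qPoch (q ^ 4) (q ^ 4) (x.2.2 l))⁻¹))
    (hag.congr_fun fun x => by
      simp only [div_eq_mul_inv, mul_inv]
      ring)
  rw [qPochInf_neg_mul_div hq] at h
  refine h.congr_fun fun x => ?_
  simp only [div_eq_mul_inv, mul_inv]
  ring

theorem hasSum_two_euler_ag_cons {q : ℂ} (hq : ‖q‖ < 1) {r i : ℕ} (hi : 1 ≤ i)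
    (hir : i ≤ r + 2) :
    HasSum (fun ((m₁, m₂, n₁, t) : ℕ × ℕ × ℕ × (Fin r → ℕ)) =>
        q ^ ((m₁ + 1).choose 2 + m₁ * n₁ + 2 * (m₂ + 1).choose 2 + 2 * m₂ * n₁ +
            4 * agExponent i (consVec n₁ t)) /
          (qPoch q q m₁ * qPoch (q ^ 2) (q ^ 2) m₂ * qPoch q q n₁ *
            ∏ l, qPoch (q ^ 4) (q ^ 4) (t l)))
      (agProduct (q ^ 4) (r + 1) i / qPochInf q q) := by
  have hag := hasSum_euler_ag_cons (norm_pow_lt_one hq two_ne_zero) hi hir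
  simp only [← pow_mul (n := 2), Nat.reduceMul] at hag
  have h := hasSum_euler_mul hq (fun x => x.2.1) (w := fun x : ℕ × ℕ × (Fin r → ℕ) =>
    (q ^ 2) ^ ((x.1 + 1).choose 2 + x.1 * x.2.1 + 2 * agExponent i (consVec x.2.1 x.2.2)) *
      ((qPoch (q ^ 2) (q ^ 2) x.1)⁻¹ * (∏ l, qPoch (q ^ 4) (q ^ 4) (x.2.2 l))⁻¹))
    (hag.congr_fun fun x => by
      simp only [div_eq_mul_inv, mul_inv]
      ring)
  rw [qPochInf_neg_mul_div hq] at h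
  refine h.congr_fun fun x => ?_
  simp only [div_eq_mul_inv, mul_inv]
  ring

theorem hasSum_euler_ag_split_head {q : ℂ} (hq : ‖q‖ < 1) {r i : ℕ} (hi : 1 ≤ i)
    (hir : i ≤ r + 2) :
    HasSum (fun ((m, n₁₁, n₁₂, t) : ℕ × ℕ × ℕ × (Fin r → ℕ)) =>
        q ^ ((m + 1).choose 2 + m * (n₁₁ + 2 * n₁₂) + n₁₁.choose 2 +
            2 * agExponent i (consVec (n₁₁ + 2 * n₁₂) t)) /
          (qPoch q q m * qPoch q q n₁₁ * qPoch (q ^ 2) (q ^ 2) n₁₂ *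
            ∏ l, qPoch (q ^ 2) (q ^ 2) (t l)))
      (agProduct (q ^ 2) (r + 1) i / qPochInf q q) := by
  have h := hasSum_split_add_two_mul hq (w := fun x : ℕ × ℕ × (Fin r → ℕ) =>
    q ^ ((x.2.1 + 1).choose 2 + x.2.1 * x.1 + 2 * agExponent i (consVec x.1 x.2.2)) *
      ((qPoch q q x.2.1)⁻¹ * (∏ l, qPoch (q ^ 2) (q ^ 2) (x.2.2 l))⁻¹))
    (((swapFirstTwo ℕ ℕ _).hasSum_iff.mpr
      (hasSum_euler_ag_cons hq hi hir)).congr_fun fun x => by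
      simp only [Function.comp, swapFirstTwo, Equiv.coe_fn_mk, div_eq_mul_inv, mul_inv]
      ring)
  let e : ℕ × ℕ × ℕ × (Fin r → ℕ) ≃ ℕ × ℕ × ℕ × (Fin r → ℕ) :=
    ⟨fun x => (x.2.1, x.2.2.1, x.1, x.2.2.2), fun y => (y.2.2.1, y.1, y.2.1, y.2.2.2),
      fun _ => rfl, fun _ => rfl⟩
  refine (e.hasSum_iff.mpr h).congr_fun fun x => ?_
  simp only [Function.comp, e, Equiv.coe_fn_mk, pow_add, div_eq_mul_inv, mul_inv]
  ring

theorem hasSum_split_euler_ag_cons {q : ℂ} (hq : ‖q‖ < 1) {r i : ℕ} (hi : 1 ≤ i)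
    (hir : i ≤ r + 2) :
    HasSum (fun ((m₁, m₂, n₁, t) : ℕ × ℕ × ℕ × (Fin r → ℕ)) =>
        q ^ (m₁.choose 2 + (m₁ + 2 * m₂ + 1).choose 2 + (m₁ + 2 * m₂) * n₁ +
            2 * agExponent i (consVec n₁ t)) /
          (qPoch q q m₁ * qPoch (q ^ 2) (q ^ 2) m₂ * qPoch q q n₁ *
            ∏ l, qPoch (q ^ 2) (q ^ 2) (t l)))
      (agProduct (q ^ 2) (r + 1) i / qPochInf q q) := by
  have h := hasSum_split_add_two_mul hq (w := fun x : ℕ × ℕ × (Fin r → ℕ) =>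
    q ^ ((x.1 + 1).choose 2 + x.1 * x.2.1 + 2 * agExponent i (consVec x.2.1 x.2.2)) *
      ((qPoch q q x.2.1)⁻¹ * (∏ l, qPoch (q ^ 2) (q ^ 2) (x.2.2 l))⁻¹))
    ((hasSum_euler_ag_cons hq hi hir).congr_fun fun x => by
      simp only [div_eq_mul_inv, mul_inv]
      ring)
  refine h.congr_fun fun x => ?_
  simp only [pow_add, div_eq_mul_inv, mul_inv]
  ring

theorem hasSum_ag_split_last {q : ℂ} (hq : ‖q‖ < 1) {r i : ℕ} (hi : 1 ≤ i) (hir : i ≤ r + 2) :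
    HasSum (fun ((t, nk₁, nk₂) : (Fin r → ℕ) × ℕ × ℕ) =>
        q ^ (nk₁.choose 2 + agExponent i (snocVec t (nk₁ + 2 * nk₂))) /
          ((∏ l, qPoch q q (t l)) * qPoch q q nk₁ * qPoch (q ^ 2) (q ^ 2) nk₂))
      (agProduct q (r + 1) i / qPochInf q q) := by
  let e : (Fin r → ℕ) × ℕ × ℕ ≃ ℕ × ℕ × (Fin r → ℕ) :=
    ⟨fun x => (x.2.1, x.2.2, x.1), fun y => (y.2.2, y.1, y.2.1), fun _ => rfl, fun _ => rfl⟩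
  refine (e.hasSum_iff.mpr
    (hasSum_split_add_two_mul hq (hasSum_ag_snoc hq hi hir))).congr_fun fun x => ?_
  simp only [Function.comp, e, Equiv.coe_fn_mk, pow_add, div_eq_mul_inv, mul_inv, prod_inv_distrib]
  ring

theorem hasSum_ag_split_head {q : ℂ} (hq : ‖q‖ < 1) {r i : ℕ} (hi : 1 ≤ i) (hir : i ≤ r + 2) :
    HasSum (fun ((n₁₁, n₁₂, t) : ℕ × ℕ × (Fin r → ℕ)) =>
        q ^ (n₁₁.choose 2 + agExponent i (consVec (n₁₁ + 2 * n₁₂) t)) /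
          (qPoch q q n₁₁ * qPoch (q ^ 2) (q ^ 2) n₁₂ * ∏ l, qPoch q q (t l)))
      (agProduct q (r + 1) i / qPochInf q q) := by
  refine (hasSum_split_add_two_mul hq (hasSum_ag_cons hq hi hir)).congr_fun fun x => ?_
  simp only [pow_add, div_eq_mul_inv, mul_inv, prod_inv_distrib]
  ring

theorem choose_two_le_agExponent_cons {r : ℕ} (i a : ℕ) (t : Fin r → ℕ) :
    a.choose 2 ≤ agExponent i (consVec a t) :=
  calc a.choose 2 ≤ a ^ 2 := Nat.choose_le_pow a 2
    _ ≤ (∑ l, consVec a t l) ^ 2 := Nat.pow_le_pow_left (by simp [consVec, Fin.sum_univ_succ]) 2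
    _ ≤ agExponent i (consVec a t) := sq_sum_le_agExponent i _

theorem hasSum_ag_cons_sub_choose {q : ℂ} (hq : ‖q‖ < 1) {r i : ℕ} (hi : 1 ≤ i)
    (hir : i ≤ r + 2) :
    HasSum (fun x : ℕ × (Fin r → ℕ) => q ^ x.1.choose 2 * (qPoch q q x.1)⁻¹ *
      (q ^ (agExponent i (consVec x.1 x.2) - x.1.choose 2) * (∏ l, qPoch q q (x.2 l))⁻¹))
      (agProduct q (r + 1) i / qPochInf q q) := by
  refine (hasSum_ag_cons hq hi hir).congr_fun fun x => ?_
  rw [← pow_mul_pow_sub q (choose_two_le_agExponent_cons i x.1 x.2), prod_inv_distrib]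
  ring

theorem cast_two_mul_choose_two (a : ℕ) : (2 * a.choose 2 : ℤ) = a ^ 2 - a := by
  rw [← Ring.choose_natCast, two_mul_ringChoose_two]
  ring

theorem hasSum_euler_ag_sub_left {q : ℂ} (hq : ‖q‖ < 1) {r i : ℕ} (hi : 1 ≤ i)
    (hir : i ≤ r + 2) :
    HasSum (fun ((m, n₁₁, n₁₂, t) : ℕ × ℕ × ℕ × (Fin r → ℕ)) =>
        q ^ (((m + 1).choose 2 : ℤ) + m * n₁₁ + n₁₁ ^ 2 + n₁₂ ^ 2 - n₁₁ -
            ((n₁₁ + n₁₂).choose 2 : ℤ) + agExponent i (consVec (n₁₁ + n₁₂) t)) /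
          (qPoch q q m * qPoch q q n₁₁ * qPoch (q ^ 2) (q ^ 2) n₁₂ * ∏ l, qPoch q q (t l)))
      (qPochInf (-q) q * agProduct q (r + 1) i / qPochInf q q) := by
  have h := hasSum_euler_mul hq Prod.fst (w := fun x : ℕ × ℕ × (Fin r → ℕ) =>
    q ^ (2 * x.1.choose 2 + 2 * x.2.1.choose 2 + x.2.1 +
      (agExponent i (consVec (x.1 + x.2.1) x.2.2) - (x.1 + x.2.1).choose 2)) *
      ((qPoch (q ^ 2) (q ^ 2) x.2.1)⁻¹ * (∏ l, qPoch q q (x.2.2 l))⁻¹))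
    ((hasSum_split_add hq (hasSum_ag_cons_sub_choose hq hi hir)).congr_fun fun x => by ring)
  rw [mul_div_assoc]
  refine h.congr_fun fun ⟨m, a, b, t⟩ => ?_
  have hexp : ((m + 1).choose 2 : ℤ) + m * a + a ^ 2 + b ^ 2 - a - ((a + b).choose 2 : ℤ) +
      agExponent i (consVec (a + b) t) = ((m + 1).choose 2 + m * a + (2 * a.choose 2 +
        2 * b.choose 2 + b + (agExponent i (consVec (a + b) t) - (a + b).choose 2)) : ℕ) := by
    push_cast [Nat.cast_sub (choose_two_le_agExponent_cons i (a + b) t)]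
    linarith [cast_two_mul_choose_two a, cast_two_mul_choose_two b]
  simp only [hexp, zpow_natCast, pow_add, div_eq_mul_inv, mul_inv]
  ring

theorem hasSum_euler_ag_sub_right {q : ℂ} (hq : ‖q‖ < 1) {r i : ℕ} (hi : 1 ≤ i)
    (hir : i ≤ r + 2) :
    HasSum (fun ((m, n₁₁, n₁₂, t) : ℕ × ℕ × ℕ × (Fin r → ℕ)) =>
        q ^ (((m + 1).choose 2 : ℤ) + m * n₁₁ + n₁₁ ^ 2 + n₁₂ ^ 2 - n₁₂ -
            ((n₁₁ + n₁₂).choose 2 : ℤ) + agExponent i (consVec (n₁₁ + n₁₂) t)) /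
          (qPoch q q m * qPoch q q n₁₁ * qPoch (q ^ 2) (q ^ 2) n₁₂ * ∏ l, qPoch q q (t l)))
      (qPochInf (-q) q * agProduct q (r + 1) i / qPochInf q q) := by
  have hsplit := (swapFirstTwo ℕ ℕ (Fin r → ℕ)).hasSum_iff.mpr
    (hasSum_split_add hq (hasSum_ag_cons_sub_choose hq hi hir))
  have h := hasSum_euler_mul hq Prod.fst (w := fun x : ℕ × ℕ × (Fin r → ℕ) =>
    q ^ (2 * x.1.choose 2 + 2 * x.2.1.choose 2 + x.1 +
      (agExponent i (consVec (x.1 + x.2.1) x.2.2) - (x.1 + x.2.1).choose 2)) *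
      ((qPoch (q ^ 2) (q ^ 2) x.2.1)⁻¹ * (∏ l, qPoch q q (x.2.2 l))⁻¹))
    (hsplit.congr_fun fun x => by
      simp only [Function.comp, swapFirstTwo, Equiv.coe_fn_mk, add_comm x.2.1 x.1]
      ring)
  rw [mul_div_assoc]
  refine h.congr_fun fun ⟨m, a, b, t⟩ => ?_
  have hexp : ((m + 1).choose 2 : ℤ) + m * a + a ^ 2 + b ^ 2 - b - ((a + b).choose 2 : ℤ) +
      agExponent i (consVec (a + b) t) = ((m + 1).choose 2 + m * a + (2 * a.choose 2 +
        2 * b.choose 2 + a + (agExponent i (consVec (a + b) t) - (a + b).choose 2)) : ℕ) := by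
    push_cast [Nat.cast_sub (choose_two_le_agExponent_cons i (a + b) t)]
    linarith [cast_two_mul_choose_two a, cast_two_mul_choose_two b]
  simp only [hexp, zpow_natCast, pow_add, div_eq_mul_inv, mul_inv]
  ring

end

theorem mainTheorem8 (q : ℂ) (hq : ‖q‖ < 1) (k i : ℕ) (hk : 1 ≤ k) (hi : 1 ≤ i)
    (hik : i ≤ k + 1) :
    -- (1) summation over `m, n₁` and `t = (n₂, …, n_k)`
    HasSum (fun ((m, n₁, t) : ℕ × ℕ × (Fin (k - 1) → ℕ)) =>
        q ^ ((m + 1).choose 2 + m * n₁ + 2 * agExponent i (consVec n₁ t)) /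
          (qPoch q q m * qPoch q q n₁ * ∏ l, qPoch (q ^ 2) (q ^ 2) (t l)))
      (qPochInf₃ (q ^ (2 * i)) (q ^ (4 * k + 6 - 2 * i)) (q ^ (4 * k + 6)) (q ^ (4 * k + 6)) /
        qPochInf q q) ∧
    -- (2) summation over `m`, `t = (n₁, …, n_{k-1})` and `n_k`
    HasSum (fun ((m, t, nk) : ℕ × (Fin (k - 1) → ℕ) × ℕ) =>
        q ^ ((m + 1).choose 2 + m * nk + 2 * agExponent i (snocVec t nk)) /
          (qPoch q q m * (∏ l, qPoch (q ^ 2) (q ^ 2) (t l)) * qPoch q q nk))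
      (qPochInf₃ (q ^ (2 * i)) (q ^ (4 * k + 6 - 2 * i)) (q ^ (4 * k + 6)) (q ^ (4 * k + 6)) /
        qPochInf q q) ∧
    -- (3) summation over `m₁, m₂, n₁` and `t = (n₂, …, n_k)`
    HasSum (fun ((m₁, m₂, n₁, t) : ℕ × ℕ × ℕ × (Fin (k - 1) → ℕ)) =>
        q ^ ((m₁ + 1).choose 2 + m₁ * m₂ + 2 * (m₂ + 1).choose 2 + 2 * m₂ * n₁ +
            4 * agExponent i (consVec n₁ t)) /
          (qPoch q q m₁ * qPoch q q m₂ * qPoch (q ^ 2) (q ^ 2) n₁ *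
            ∏ l, qPoch (q ^ 4) (q ^ 4) (t l)))
      (qPochInf₃ (q ^ (4 * i)) (q ^ (8 * k + 12 - 4 * i)) (q ^ (8 * k + 12)) (q ^ (8 * k + 12)) /
        qPochInf q q) ∧
    -- (4) summation over `m, n₁₁, n₁₂` and `t = (n₂, …, n_k)`, with `n₁ = n₁₁ + 2 n₁₂`
    HasSum (fun ((m, n₁₁, n₁₂, t) : ℕ × ℕ × ℕ × (Fin (k - 1) → ℕ)) =>
        q ^ ((m + 1).choose 2 + m * (n₁₁ + 2 * n₁₂) + n₁₁.choose 2 +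
            2 * agExponent i (consVec (n₁₁ + 2 * n₁₂) t)) /
          (qPoch q q m * qPoch q q n₁₁ * qPoch (q ^ 2) (q ^ 2) n₁₂ *
            ∏ l, qPoch (q ^ 2) (q ^ 2) (t l)))
      (qPochInf₃ (q ^ (2 * i)) (q ^ (4 * k + 6 - 2 * i)) (q ^ (4 * k + 6)) (q ^ (4 * k + 6)) /
        qPochInf q q) ∧
    -- (5) summation over `m₁, m₂, n₁` and `t = (n₂, …, n_k)`
    HasSum (fun ((m₁, m₂, n₁, t) : ℕ × ℕ × ℕ × (Fin (k - 1) → ℕ)) =>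
        q ^ ((m₁ + 1).choose 2 + m₁ * n₁ + 2 * (m₂ + 1).choose 2 + 2 * m₂ * n₁ +
            4 * agExponent i (consVec n₁ t)) /
          (qPoch q q m₁ * qPoch (q ^ 2) (q ^ 2) m₂ * qPoch q q n₁ *
            ∏ l, qPoch (q ^ 4) (q ^ 4) (t l)))
      (qPochInf₃ (q ^ (4 * i)) (q ^ (8 * k + 12 - 4 * i)) (q ^ (8 * k + 12)) (q ^ (8 * k + 12)) /
        qPochInf q q) ∧
    -- (6) summation over `m₁, m₂, n₁` and `t = (n₂, …, n_k)`
    HasSum (fun ((m₁, m₂, n₁, t) : ℕ × ℕ × ℕ × (Fin (k - 1) → ℕ)) =>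
        q ^ (m₁.choose 2 + (m₁ + 2 * m₂ + 1).choose 2 + (m₁ + 2 * m₂) * n₁ +
            2 * agExponent i (consVec n₁ t)) /
          (qPoch q q m₁ * qPoch (q ^ 2) (q ^ 2) m₂ * qPoch q q n₁ *
            ∏ l, qPoch (q ^ 2) (q ^ 2) (t l)))
      (qPochInf₃ (q ^ (2 * i)) (q ^ (4 * k + 6 - 2 * i)) (q ^ (4 * k + 6)) (q ^ (4 * k + 6)) /
        qPochInf q q) ∧
    -- (7) summation over `t = (n₁, …, n_{k-1})` and `nk₁, nk₂`, with `n_k = nk₁ + 2 nk₂`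
    HasSum (fun ((t, nk₁, nk₂) : (Fin (k - 1) → ℕ) × ℕ × ℕ) =>
        q ^ (nk₁.choose 2 + agExponent i (snocVec t (nk₁ + 2 * nk₂))) /
          ((∏ l, qPoch q q (t l)) * qPoch q q nk₁ * qPoch (q ^ 2) (q ^ 2) nk₂))
      (qPochInf₃ (q ^ i) (q ^ (2 * k + 3 - i)) (q ^ (2 * k + 3)) (q ^ (2 * k + 3)) /
        qPochInf q q) ∧
    -- (8) summation over `n₁₁, n₁₂` and `t = (n₂, …, n_k)`, with `n₁ = n₁₁ + 2 n₁₂`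
    HasSum (fun ((n₁₁, n₁₂, t) : ℕ × ℕ × (Fin (k - 1) → ℕ)) =>
        q ^ (n₁₁.choose 2 + agExponent i (consVec (n₁₁ + 2 * n₁₂) t)) /
          (qPoch q q n₁₁ * qPoch (q ^ 2) (q ^ 2) n₁₂ * ∏ l, qPoch q q (t l)))
      (qPochInf₃ (q ^ i) (q ^ (2 * k + 3 - i)) (q ^ (2 * k + 3)) (q ^ (2 * k + 3)) /
        qPochInf q q) ∧
    -- (9) summation over `m, n₁₁, n₁₂` and `t = (n₂, …, n_k)`,
    -- with `n₁ = n₁₁ + n₁₂`; the exponent is an integer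
    HasSum (fun ((m, n₁₁, n₁₂, t) : ℕ × ℕ × ℕ × (Fin (k - 1) → ℕ)) =>
        q ^ (((m + 1).choose 2 : ℤ) + m * n₁₁ + n₁₁ ^ 2 + n₁₂ ^ 2 - n₁₁ -
            ((n₁₁ + n₁₂).choose 2 : ℤ) + agExponent i (consVec (n₁₁ + n₁₂) t)) /
          (qPoch q q m * qPoch q q n₁₁ * qPoch (q ^ 2) (q ^ 2) n₁₂ * ∏ l, qPoch q q (t l)))
      (qPochInf (-q) q *
        qPochInf₃ (q ^ i) (q ^ (2 * k + 3 - i)) (q ^ (2 * k + 3)) (q ^ (2 * k + 3)) /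
        qPochInf q q) ∧
    -- (10) as before, with `- n₁₂` in place of `- n₁₁` in the exponent
    HasSum (fun ((m, n₁₁, n₁₂, t) : ℕ × ℕ × ℕ × (Fin (k - 1) → ℕ)) =>
        q ^ (((m + 1).choose 2 : ℤ) + m * n₁₁ + n₁₁ ^ 2 + n₁₂ ^ 2 - n₁₂ -
            ((n₁₁ + n₁₂).choose 2 : ℤ) + agExponent i (consVec (n₁₁ + n₁₂) t)) /
          (qPoch q q m * qPoch q q n₁₁ * qPoch (q ^ 2) (q ^ 2) n₁₂ * ∏ l, qPoch q q (t l)))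
      (qPochInf (-q) q *
        qPochInf₃ (q ^ i) (q ^ (2 * k + 3 - i)) (q ^ (2 * k + 3)) (q ^ (2 * k + 3)) /
        qPochInf q q) := by
  obtain ⟨r, rfl⟩ := Nat.exists_eq_add_of_le' hk
  simp only [← agProduct_pow_two, ← agProduct_pow_four]
  exact ⟨hasSum_euler_ag_cons hq hi hik, hasSum_euler_ag_snoc hq hi hik,
    hasSum_euler_euler_ag_cons hq hi hik, hasSum_euler_ag_split_head hq hi hik,
    hasSum_two_euler_ag_cons hq hi hik, hasSum_split_euler_ag_cons hq hi hik,
    hasSum_ag_split_last hq hi hik, hasSum_ag_split_head hq hi hik,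
    hasSum_euler_ag_sub_left hq hi hik, hasSum_euler_ag_sub_right hq hi hik⟩
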